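/- For integers $p,q,r\ge 1$ with $r\le p$ and $s\in\mathbb Z$, let $T(p,q,r,s)\subset S^3$ denote the twisted torus link obtained from the $(p,q)$-torus link, viewed as the closure of the $p$-strand braid $(\sigma_1\sigma_2\cdots\sigma_{p-1})^q$, by performing $s$ full twists on $r$ adjacent strands; that is, the closure of the $p$-strand braid $(\sigma_1\cdots\sigma_{p-1})^q(\sigma_1\cdots\sigma_{r-1})^{rs}$. (Both rotations are in the same sense when $q,s>0$.) Lemma. For all integers $m,n\ge 2$, the twisted torus link $T(mn,m,m,-n)$ is the $m$-component unlink, i.e. it is ambient isotopic in $S^3$ to a union of $m$ pairwise disjoint round circles bounding pairwise disjoint disks. -/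

import Mathlib

noncomputable section

namespace TwistedTorus

/-- The three-sphere, as the unit sphere of `ℂ²`; points are written `(z, w)`. -/
abbrev S3 : Type := {x : ℂ × ℂ // ‖x.1‖ ^ 2 + ‖x.2‖ ^ 2 = 1}

/-- Two subsets of the three-sphere are ambient isotopic if some continuous one-parameter family of
self-homeomorphisms of the sphere starts at the identity and ends at a homeomorphism that carries
the first onto the second. -/
def AmbientIsotopic (A B : Set S3) : Prop :=
  ∃ H : unitInterval → (S3 ≃ₜ S3),
    Continuous (fun x : unitInterval × S3 => H x.1 x.2) ∧
    (∀ x : S3, H 0 x = x) ∧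
    (fun x : S3 => H 1 x) '' A = B

/-- The standard unlink with `m` components: the `m` pairwise disjoint round circles
`{(z, w) ∈ S³ : z = k / (m + 1)}`, `k = 0, …, m - 1`. They are parallel circles of the great
two-sphere `Im z = 0` (a plane, after stereographic projection), and the `k`-th one bounds the
round disk `{Re z = k / (m + 1), Im z ≥ 0}` of the sphere; these disks are pairwise disjoint. -/
def standardUnlink (m : ℕ) : Set S3 :=
  {x | ∃ k : Fin m, x.1.1 = ((k : ℕ) : ℂ) / ((m : ℂ) + 1)}

/-- A link in the three-sphere is the `m`-component unlink if it is ambient isotopic to the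
standard one. -/
def IsUnlink (m : ℕ) (L : Set S3) : Prop :=
  AmbientIsotopic L (standardUnlink m)

/-- The point of the three-sphere with coordinates `(ζ, exp (2 π i t))` in the open solid torus
`ℂ × S¹`, which is identified with the complement of the circle `w = 0` (the braid axis) through
`(ζ, u) ↦ (ζ, u) / √(1 + |ζ|²)`, that is, `ζ = z / |w|` and `u = w / |w|`. The circles on which `ζ`
is constant are pairwise unlinked. -/
def solidTorusPoint (ζ : ℂ) (t : ℝ) : S3 :=
  ⟨(ζ / (√(1 + ‖ζ‖ ^ 2) : ℝ),
    Complex.exp (2 * Real.pi * t * Complex.I) / (√(1 + ‖ζ‖ ^ 2) : ℝ)), by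
    have h : (0 : ℝ) < 1 + ‖ζ‖ ^ 2 := by positivity
    have h1 : ‖Complex.exp (2 * Real.pi * t * Complex.I)‖ = 1 := by
      have := Complex.norm_exp_ofReal_mul_I (2 * Real.pi * t)
      simpa using this
    have h2 : ‖((√(1 + ‖ζ‖ ^ 2) : ℝ) : ℂ)‖ = √(1 + ‖ζ‖ ^ 2) := by
      rw [Complex.norm_real, Real.norm_of_nonneg (Real.sqrt_nonneg _)]
    simp only [norm_div, h1, h2, div_pow, Real.sq_sqrt h.le]
    field_simp
    ring⟩

/-- The closure, about the axis `w = 0`, of the geometric braid in which the `j`-th of `n` points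
of the plane is at `γ j t` at time `t ∈ [0, 1]`. -/
def braidClosure {n : ℕ} (γ : Fin n → ℝ → ℂ) : Set S3 :=
  {x | ∃ j : Fin n, ∃ t ∈ Set.Icc (0 : ℝ) 1, x = solidTorusPoint (γ j t) t}

/-- The point `exp (2 π i a / p)` of the unit circle; for `a = 0, …, p - 1` these are the `p`
equally spaced base points of the strands. -/
def circlePoint (p : ℕ) (a : ℝ) : ℂ :=
  Complex.exp (2 * Real.pi * (a / p) * Complex.I)

/-- The `s`-fold full twist on the first `r` of `p` strands, at time `t ∈ [0, 1]`: the `r` adjacent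
base points `0, …, r - 1` are rotated rigidly, through the total angle `2 π s`, about the midpoint
of the arc of the unit circle that they span, and the other base points stay where they are. (The
other base points are farther from that midpoint than the first `r`, so a round disk that holds
exactly the first `r` points is rotated.) -/
def fullTwistStrand (p r : ℕ) (s : ℤ) (k : ℕ) (t : ℝ) : ℂ :=
  if k < r then
    circlePoint p (((r : ℝ) - 1) / 2) +
      Complex.exp (2 * Real.pi * s * t * Complex.I) *
        (circlePoint p k - circlePoint p (((r : ℝ) - 1) / 2))
  else circlePoint p k

/-- The geometric braid on `p` strands of the twisted torus link. For `0 ≤ t ≤ 1/2` the `p` equally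
spaced points rotate together through the angle `2 π q / p` (the braid `(σ₁ ⋯ σ_{p-1})^q`, whose
closure lies on the torus `|z| = |w|` and is the `(p, q)`-torus link), which takes the base point `j`
to the base point `j + q` modulo `p`; for `1/2 ≤ t ≤ 1` the first `r` strands undergo `s` full twists
(the braid `(σ₁ ⋯ σ_{r-1})^(r s)`). Both rotations are counterclockwise for positive `q` and `s`. -/
def twistedTorusStrand (p q r : ℕ) (s : ℤ) (j : Fin p) (t : ℝ) : ℂ :=
  if t ≤ 1 / 2 then circlePoint p ((j : ℕ) + q * (2 * t))
  else fullTwistStrand p r s (((j : ℕ) + q) % p) (2 * t - 1)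

/-- The twisted torus link `T(p, q, r, s)` in the three-sphere, for `1 ≤ r ≤ p`: the `(p, q)`-torus
link with `s` full twists performed on `r` adjacent ones of its `p` strands. -/
def twistedTorusLink (p q r : ℕ) (s : ℤ) : Set S3 :=
  braidClosure (twistedTorusStrand p q r s)

end TwistedTorus

end

/-! Split the `m * n` strands into `n` blocks of `m` neighbours. The rotation through `2π/n` carries
each block to the next, so the blocks follow one closed curve, the `(n, 1)`-torus knot, which winds
`n` times about the axis `w = 0` but only once about the axis `z = 0`. In the frame that rotates
with this curve, a block turns about its centre through `-2πn` in total, all of it while the last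
block comes back to the start. Spread evenly along the curve, this is one negative turn for each of
the `n` turns about `w = 0`: with `θ = arg w`, the strand with parameter `b` is displaced from the
centre by `-b e^{-iθ}` in the coordinate `log ζ`.

Exchange the two axes. With `v` of modulus one as the new angular coordinate (up to sign), the curve
becomes the closed 1-braid `v ↦ v ^ n`, and the strand with parameter `b` becomes, after a small
deformation, `v ↦ v ^ n + b`. The displacement no longer depends on `v`: the components are
translates of one another. Contracting `v ^ n` to `0` makes all of them constant, and constant
braids close up to the standard unlink.

Every deformation is a homotopy through closed braids with distinct points at each time, which
`ambientIsotopic_of_braidHomotopy` turns into an ambient isotopy. The successive deformations are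
`ambientIsotopic_shrink`, `ambientIsotopic_log`, `ambientIsotopic_spread` and
`ambientIsotopic_circle`; `image_groupClosure_circle` is the exchange of axes, and
`isUnlink_translates` the contraction. -/

noncomputable section

namespace TwistedTorus

open Set Filter Topology
open scoped unitInterval

/-! ### The open book with disk pages, and ambient isotopies of the three-sphere -/

/-- The closed unit disk. -/
abbrev Disk : Type := Metric.closedBall (0 : ℂ) 1

lemma norm_exp_two_pi_mul (t : ℝ) : ‖Complex.exp (2 * Real.pi * t * Complex.I)‖ = 1 := by
  have := Complex.norm_exp_ofReal_mul_I (2 * Real.pi * t)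
  simpa using this

lemma Disk.norm_le (z : Disk) : ‖(z : ℂ)‖ ≤ 1 := mem_closedBall_zero_iff.1 z.2

lemma Disk.one_sub_sq_nonneg (z : Disk) : 0 ≤ 1 - ‖(z : ℂ)‖ ^ 2 := by
  have := z.norm_le
  have := norm_nonneg (z : ℂ)
  nlinarith

/-- The open book decomposition of the three-sphere with disk pages: the point of the page at angle
`2 π t` with first coordinate `z`. -/
def page (t : ℝ) (z : Disk) : S3 :=
  ⟨(z, (√(1 - ‖(z : ℂ)‖ ^ 2) : ℝ) * Complex.exp (2 * Real.pi * t * Complex.I)), by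
    simp only [norm_mul, norm_exp_two_pi_mul, Complex.norm_real, mul_one, Real.norm_eq_abs, sq_abs,
      Real.sq_sqrt z.one_sub_sq_nonneg]
    ring⟩

lemma continuous_page : Continuous fun x : ℝ × Disk => page x.1 x.2 := by
  unfold page
  fun_prop

lemma exists_exp_eq_of_norm_eq_one {u : ℂ} (hu : ‖u‖ = 1) :
    ∃ t ∈ Icc (0 : ℝ) 1, Complex.exp (2 * Real.pi * t * Complex.I) = u := by
  obtain ⟨y, hy⟩ : ∃ y : ℝ, Complex.exp (y * Complex.I) = u := by
    refine ⟨Complex.arg u, ?_⟩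
    simpa [hu] using Complex.norm_mul_exp_arg_mul_I u
  refine ⟨Int.fract (y / (2 * Real.pi)), ⟨Int.fract_nonneg _, (Int.fract_lt_one _).le⟩, ?_⟩
  rw [← hy, Complex.exp_eq_exp_iff_exists_int]
  refine ⟨-⌊y / (2 * Real.pi)⌋, ?_⟩
  have hpi : (Real.pi : ℂ) ≠ 0 := by exact_mod_cast Real.pi_ne_zero
  rw [Int.fract]
  push_cast
  field_simp
  ring

lemma exists_page_eq (x : S3) : ∃ t ∈ Icc (0 : ℝ) 1, ∃ z : Disk, page t z = x := by
  obtain ⟨⟨z, w⟩, hx⟩ := x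
  simp only at hx
  have hz : ‖z‖ ≤ 1 := by nlinarith [norm_nonneg z, sq_nonneg ‖w‖]
  have hw : √(1 - ‖z‖ ^ 2) = ‖w‖ := by
    rw [show 1 - ‖z‖ ^ 2 = ‖w‖ ^ 2 by linarith, Real.sqrt_sq (norm_nonneg w)]
  obtain ⟨u, hu, huw⟩ : ∃ u : ℂ, ‖u‖ = 1 ∧ (‖w‖ : ℂ) * u = w := by
    by_cases h : w = 0
    · exact ⟨1, by simp, by simp [h]⟩
    · have h' : (‖w‖ : ℂ) ≠ 0 := by simpa using h
      exact ⟨w / ‖w‖, by simp [h], by field_simp⟩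
  obtain ⟨t, ht, rfl⟩ := exists_exp_eq_of_norm_eq_one hu
  refine ⟨t, ht, ⟨z, mem_closedBall_zero_iff.2 hz⟩, ?_⟩
  apply Subtype.ext
  simp only [page, hw, huw]

lemma exp_two_pi_mul_eq_iff {t t' : ℝ} (ht : t ∈ Icc (0 : ℝ) 1) (ht' : t' ∈ Icc (0 : ℝ) 1)
    (h : Complex.exp (2 * Real.pi * t * Complex.I) = Complex.exp (2 * Real.pi * t' * Complex.I)) :
    t = t' ∨ (t = 0 ∧ t' = 1) ∨ (t = 1 ∧ t' = 0) := by
  rw [Complex.exp_eq_exp_iff_exists_int] at h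
  obtain ⟨k, hk⟩ := h
  have hpi : (Real.pi : ℂ) ≠ 0 := by exact_mod_cast Real.pi_ne_zero
  have h1 : t = t' + k := by
    have : (t : ℂ) = t' + k := by
      have h2 : (2 * Real.pi * Complex.I) * (t : ℂ) = (2 * Real.pi * Complex.I) * (t' + k) := by
        linear_combination hk
      exact mul_left_cancel₀ Complex.two_pi_I_ne_zero h2
    exact_mod_cast this
  obtain ⟨a0, a1⟩ := ht
  obtain ⟨b0, b1⟩ := ht'
  have k1 : k ≤ 1 := by
    have : (k : ℝ) ≤ 1 := by linarith
    exact_mod_cast this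
  have k2 : -1 ≤ k := by
    have : (-1 : ℝ) ≤ k := by linarith
    exact_mod_cast this
  obtain rfl | rfl | rfl : k = -1 ∨ k = 0 ∨ k = 1 := by omega
  · push_cast at h1
    exact Or.inr (Or.inl ⟨by linarith, by linarith⟩)
  · left; simpa using h1
  · push_cast at h1
    exact Or.inr (Or.inr ⟨by linarith, by linarith⟩)

/-- These are the only identifications made by `page` on `[0, 1] × Disk`: a map defined page by page
descends to the sphere once it respects them. -/
lemma page_eq_page {t t' : ℝ} (ht : t ∈ Icc (0 : ℝ) 1) (ht' : t' ∈ Icc (0 : ℝ) 1) {z z' : Disk}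
    (h : page t z = page t' z') :
    z = z' ∧ (‖(z : ℂ)‖ = 1 ∨ t = t' ∨ (t = 0 ∧ t' = 1) ∨ (t = 1 ∧ t' = 0)) := by
  have h1 := congrArg (fun x : S3 => x.1.1) h
  have h2 := congrArg (fun x : S3 => x.1.2) h
  simp only [page] at h1 h2
  have hz : z = z' := Subtype.ext h1
  refine ⟨hz, ?_⟩
  subst hz
  by_cases hn : ‖(z : ℂ)‖ = 1
  · exact Or.inl hn
  right
  apply exp_two_pi_mul_eq_iff ht ht'
  have : ((√(1 - ‖(z : ℂ)‖ ^ 2) : ℝ) : ℂ) ≠ 0 := by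
    have := lt_of_le_of_ne z.norm_le hn
    have := norm_nonneg (z : ℂ)
    have h0 : 0 < 1 - ‖(z : ℂ)‖ ^ 2 := by nlinarith
    exact_mod_cast (Real.sqrt_pos.2 h0).ne'
  exact mul_left_cancel₀ this h2

lemma page_eq_of_norm_eq_one (t t' : ℝ) {z : Disk} (hz : ‖(z : ℂ)‖ = 1) : page t z = page t' z := by
  apply Subtype.ext
  simp [page, hz]

lemma page_zero (z : Disk) : page 0 z = page 1 z := by
  apply Subtype.ext
  simp [page, Complex.exp_two_pi_mul_I]

instance : CompactSpace S3 := by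
  have hs : Function.Surjective fun x : I × Disk => page x.1 x.2 := by
    intro x
    obtain ⟨t, ht, z, rfl⟩ := exists_page_eq x
    exact ⟨(⟨t, ht⟩, z), rfl⟩
  have hc : Continuous fun x : I × Disk => page x.1 x.2 :=
    continuous_page.comp (by fun_prop : Continuous fun x : I × Disk => ((x.1 : ℝ), x.2))
  exact ⟨by simpa [hs.range_eq] using isCompact_range hc⟩

/-- A continuous family of bijections of the three-sphere that starts at the identity is an ambient
isotopy. -/
lemma ambientIsotopic_of_bijective (H : I → S3 → S3)
    (hc : Continuous fun x : I × S3 => H x.1 x.2) (hb : ∀ s, Function.Bijective (H s))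
    (h0 : ∀ x, H 0 x = x) (A : Set S3) : AmbientIsotopic A (H 1 '' A) := by
  have hs : ∀ s, Continuous (H s) := fun s => hc.comp (by fun_prop : Continuous fun x : S3 => (s, x))
  refine ⟨fun s => Continuous.homeoOfEquivCompactToT2 (f := Equiv.ofBijective (H s) (hb s)) (hs s),
    hc, h0, rfl⟩

lemma AmbientIsotopic.symm {A B : Set S3} (h : AmbientIsotopic A B) : AmbientIsotopic B A := by
  obtain ⟨H, hc, h0, rfl⟩ := h
  let e : I × S3 ≃ I × S3 :=
    { toFun := fun x => (x.1, H x.1 x.2)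
      invFun := fun x => (x.1, (H x.1).symm x.2)
      left_inv := fun x => by simp
      right_inv := fun x => by simp }
  have he : Continuous e := continuous_fst.prodMk hc
  have hi : Continuous e.symm := (Continuous.homeoOfEquivCompactToT2 (f := e) he).symm.continuous
  refine ⟨fun s => (H s).symm, continuous_snd.comp hi, fun x => ?_, ?_⟩
  · rw [Homeomorph.symm_apply_eq, h0]
  · rw [image_image]
    simp

lemma AmbientIsotopic.trans {A B C : Set S3} (h : AmbientIsotopic A B) (h' : AmbientIsotopic B C) :
    AmbientIsotopic A C := by
  obtain ⟨H, hc, h0, rfl⟩ := h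
  obtain ⟨K, kc, k0, rfl⟩ := h'
  refine ⟨fun s => (H s).trans (K s), ?_, fun x => by simp [h0, k0], ?_⟩
  · exact kc.comp (continuous_fst.prodMk hc)
  · simp [image_image]

/-- A family of bijections of the pages that fix the binding is an ambient isotopy. -/
lemma ambientIsotopic_of_pages (h : I → ℝ → Disk → Disk)
    (hc : Continuous fun x : I × I × Disk => h x.1 x.2.1 x.2.2)
    (hb : ∀ s t, t ∈ Icc (0 : ℝ) 1 → Function.Bijective (h s t))
    (hfix : ∀ s t (z : Disk), ‖(z : ℂ)‖ = 1 → h s t z = z)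
    (h01 : ∀ s, h s 0 = h s 1) (h0 : ∀ t z, h 0 t z = z) (A B : Set S3)
    (hA : ∀ x ∈ A, ∃ t ∈ Icc (0 : ℝ) 1, ∃ z, x = page t z ∧ page t (h 1 t z) ∈ B)
    (hB : ∀ x ∈ B, ∃ t ∈ Icc (0 : ℝ) 1, ∃ z, page t z ∈ A ∧ page t (h 1 t z) = x) :
    AmbientIsotopic A B := by
  -- Any choice of preimages will do: `hfix` and `h01` make the result independent of it, which is
  -- `hdesc`.
  choose τ hτ ζ hζ using exists_page_eq
  let H : I → S3 → S3 := fun s x => page (τ x) (h s (τ x) (ζ x))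
  have hdesc : ∀ s t z, t ∈ Icc (0 : ℝ) 1 → H s (page t z) = page t (h s t z) := by
    intro s t z ht
    obtain ⟨e, hcase⟩ := page_eq_page (hτ (page t z)) ht (hζ (page t z))
    simp only [H]
    rw [e] at hcase ⊢
    rcases hcase with h | h | ⟨h, h'⟩ | ⟨h, h'⟩
    · rw [hfix _ _ _ h, hfix _ _ _ h]
      exact page_eq_of_norm_eq_one _ _ h
    · rw [h]
    · rw [h, h', h01, page_zero]
    · rw [h, h', h01, page_zero]
  -- A continuous surjection from a compact space onto a Hausdorff one is a quotient map, so
  -- continuity of `H` can be tested on `I × I × Disk`.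
  have hq : IsQuotientMap fun x : I × I × Disk => (x.1, page x.2.1 x.2.2) := by
    have c : Continuous fun x : I × I × Disk => (x.1, page x.2.1 x.2.2) :=
      continuous_fst.prodMk (continuous_page.comp
        (by fun_prop : Continuous fun x : I × I × Disk => ((x.2.1 : ℝ), x.2.2)))
    refine c.isClosedMap.isQuotientMap c ?_
    rintro ⟨s, x⟩
    obtain ⟨t, ht, z, rfl⟩ := exists_page_eq x
    exact ⟨(s, ⟨t, ht⟩, z), rfl⟩
  have Hc : Continuous fun x : I × S3 => H x.1 x.2 := by
    rw [hq.continuous_iff]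
    have : ((fun x : I × S3 => H x.1 x.2) ∘ fun x : I × I × Disk => (x.1, page x.2.1 x.2.2)) =
        fun x : I × I × Disk => page x.2.1 (h x.1 x.2.1 x.2.2) := by
      ext1 x
      exact hdesc _ _ _ x.2.1.2
    rw [this]
    exact continuous_page.comp
      ((by fun_prop : Continuous fun x : I × I × Disk => (x.2.1 : ℝ)).prodMk hc)
  have Hb : ∀ s, Function.Bijective (H s) := by
    intro s
    have hone : ∀ t z, t ∈ Icc (0 : ℝ) 1 → ‖(h s t z : ℂ)‖ = 1 → h s t z = z := by
      intro t z ht hz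
      exact (hb s t ht).1 (hfix s t _ hz)
    constructor
    · intro x y hxy
      obtain ⟨t, ht, z, rfl⟩ := exists_page_eq x
      obtain ⟨t', ht', z', rfl⟩ := exists_page_eq y
      rw [hdesc _ _ _ ht, hdesc _ _ _ ht'] at hxy
      obtain ⟨e, hcase⟩ := page_eq_page ht ht' hxy
      rcases hcase with hn | rfl | ⟨rfl, rfl⟩ | ⟨rfl, rfl⟩
      · have e1 := hone t z ht hn
        rw [e] at hn
        have e2 := hone t' z' ht' hn
        rw [e1, e2] at e
        subst e
        rw [e2] at hn
        exact page_eq_of_norm_eq_one _ _ hn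
      · rw [(hb s t ht).1 e]
      · rw [h01] at e
        rw [(hb s 1 ht').1 e, page_zero]
      · rw [h01] at e
        rw [(hb s 1 ht).1 e, page_zero]
    · intro x
      obtain ⟨t, ht, z, rfl⟩ := exists_page_eq x
      obtain ⟨z', rfl⟩ := (hb s t ht).2 z
      exact ⟨page t z', hdesc _ _ _ ht⟩
  have H0 : ∀ x, H 0 x = x := fun x => by simp only [H, h0, hζ]
  have hAB : H 1 '' A = B := by
    ext x
    constructor
    · rintro ⟨y, hy, rfl⟩
      obtain ⟨t, ht, z, rfl, hz⟩ := hA y hy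
      rwa [hdesc _ _ _ ht]
    · intro hx
      obtain ⟨t, ht, z, hz, rfl⟩ := hB x hx
      exact ⟨_, hz, hdesc _ _ _ ht⟩
  rw [← hAB]
  exact ambientIsotopic_of_bijective H Hc Hb H0 A

/-! ### Moving finitely many points of the disk by small bumps -/

section Push

variable {ι : Type*} [Fintype ι]

/-- The map of the plane that pushes each `a j` along the vector `v j`, with support in the disks of
radius `d` about the points `a j`. -/
def push (d : ℝ) (a v : ι → ℂ) (z : ℂ) : ℂ :=
  z + ∑ j, ((max 0 (1 - ‖z - a j‖ / d) : ℝ) : ℂ) * v j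

/-- Each bump is `1/d`-Lipschitz, so each of the `N` summands has Lipschitz constant at most
`1/(2(N+1))`. Thus `push` is the identity plus a contraction, hence bijective. -/
lemma norm_push_sub_sub_le {d : ℝ} (hd : 0 < d) {a v : ι → ℂ}
    (hv : ∀ j, ‖v j‖ ≤ d / (2 * (Fintype.card ι + 1))) (z z' : ℂ) :
    ‖(push d a v z - z) - (push d a v z' - z')‖ ≤ 1 / 2 * ‖z - z'‖ := by
  have hN : (0 : ℝ) < Fintype.card ι + 1 := by positivity
  have e : (push d a v z - z) - (push d a v z' - z') =
      ∑ j, ((max 0 (1 - ‖z - a j‖ / d) - max 0 (1 - ‖z' - a j‖ / d) : ℝ) : ℂ) * v j := by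
    simp only [push, add_sub_cancel_left, ← Finset.sum_sub_distrib]
    refine Finset.sum_congr rfl fun j _ => ?_
    push_cast
    ring
  rw [e]
  refine (norm_sum_le _ _).trans ?_
  have hj : ∀ j ∈ (Finset.univ : Finset ι),
      ‖((max 0 (1 - ‖z - a j‖ / d) - max 0 (1 - ‖z' - a j‖ / d) : ℝ) : ℂ) * v j‖ ≤
        1 / (2 * (Fintype.card ι + 1)) * ‖z - z'‖ := by
    intro j _
    rw [norm_mul, Complex.norm_real, Real.norm_eq_abs]
    have h1 : |max 0 (1 - ‖z - a j‖ / d) - max 0 (1 - ‖z' - a j‖ / d)| ≤ ‖z - z'‖ / d := by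
      refine (abs_max_sub_max_le_max _ _ _ _).trans ?_
      rw [sub_self, abs_zero]
      refine max_le (by positivity) ?_
      rw [show 1 - ‖z - a j‖ / d - (1 - ‖z' - a j‖ / d) = (‖z' - a j‖ - ‖z - a j‖) / d by ring,
        abs_div, abs_of_pos hd]
      gcongr
      refine (abs_norm_sub_norm_le _ _).trans ?_
      rw [show z' - a j - (z - a j) = -(z - z') by ring, norm_neg]
    calc _ ≤ ‖z - z'‖ / d * (d / (2 * (Fintype.card ι + 1))) := by
          gcongr
          exact hv j
      _ = _ := by field_simp
  refine (Finset.sum_le_sum hj).trans ?_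
  rw [Finset.sum_const, Finset.card_univ, nsmul_eq_mul, ← mul_assoc]
  gcongr
  rw [mul_one_div, div_le_div_iff₀ (by positivity) (by norm_num)]
  linarith

lemma push_injective {d : ℝ} (hd : 0 < d) {a v : ι → ℂ}
    (hv : ∀ j, ‖v j‖ ≤ d / (2 * (Fintype.card ι + 1))) : Function.Injective (push d a v) := by
  intro z z' h
  have := norm_push_sub_sub_le hd (a := a) hv z z'
  rw [h, show push d a v z' - z - (push d a v z' - z') = -(z - z') by ring, norm_neg] at this
  have : ‖z - z'‖ = 0 := by linarith [norm_nonneg (z - z')]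
  exact sub_eq_zero.1 (norm_eq_zero.1 this)

lemma push_surjective {d : ℝ} (hd : 0 < d) {a v : ι → ℂ}
    (hv : ∀ j, ‖v j‖ ≤ d / (2 * (Fintype.card ι + 1))) : Function.Surjective (push d a v) := by
  intro y
  -- A fixed point `z` of this contraction satisfies `push d a v z = y`.
  have hf : ContractingWith (1 / 2) fun z => y - (push d a v z - z) := by
    refine ⟨by norm_num, LipschitzWith.of_dist_le_mul fun z z' => ?_⟩
    rw [dist_eq_norm, dist_eq_norm,
      show y - (push d a v z - z) - (y - (push d a v z' - z')) =
        -((push d a v z - z) - (push d a v z' - z')) by ring, norm_neg]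
    simpa using norm_push_sub_sub_le hd hv z z'
  refine ⟨hf.fixedPoint _, ?_⟩
  have := hf.fixedPoint_isFixedPt
  rw [Function.IsFixedPt] at this
  linear_combination -this

lemma push_eq_self {d : ℝ} (hd : 0 < d) {a v : ι → ℂ} (ha : ∀ j, ‖a j‖ ≤ 1 - d) {z : ℂ}
    (hz : 1 ≤ ‖z‖) : push d a v z = z := by
  rw [push, add_eq_left]
  refine Finset.sum_eq_zero fun j _ => ?_
  have h1 : d ≤ ‖z - a j‖ := by
    have := norm_sub_norm_le z (a j)
    have := ha j
    linarith
  rw [max_eq_left]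
  · simp
  · rw [sub_nonpos, le_div_iff₀ hd]
    linarith

/-- A value outside the disk would itself be fixed, and injectivity would make it equal to `z`. -/
lemma norm_push_le {d : ℝ} (hd : 0 < d) {a v : ι → ℂ} (ha : ∀ j, ‖a j‖ ≤ 1 - d)
    (hv : ∀ j, ‖v j‖ ≤ d / (2 * (Fintype.card ι + 1))) {z : ℂ} (hz : ‖z‖ ≤ 1) :
    ‖push d a v z‖ ≤ 1 := by
  by_contra! h
  have h1 := push_injective hd hv (push_eq_self (v := v) hd ha h.le)
  rw [h1] at h
  linarith

lemma push_apply {d : ℝ} (hd : 0 < d) {a v : ι → ℂ} (ha : ∀ i j, i ≠ j → d ≤ ‖a i - a j‖) (i : ι) :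
    push d a v (a i) = a i + v i := by
  classical
  rw [push, Finset.sum_eq_single i]
  · simp
  · intro j _ hj
    rw [max_eq_left]
    · simp
    · rw [sub_nonpos, le_div_iff₀ hd]
      linarith [ha i j hj.symm]
  · simp

end Push

/-! ### Homotopies of closed braids extend to ambient isotopies -/

/-- The closure of the geometric braid with strands indexed by an arbitrary type. -/
def strandClosure {ι : Type*} (γ : ι → ℝ → ℂ) : Set S3 :=
  {x | ∃ j, ∃ t ∈ Icc (0 : ℝ) 1, x = solidTorusPoint (γ j t) t}

lemma norm_div_sqrt_lt_one (ζ : ℂ) : ‖ζ / (√(1 + ‖ζ‖ ^ 2) : ℝ)‖ < 1 := by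
  have h : (0 : ℝ) < 1 + ‖ζ‖ ^ 2 := by positivity
  rw [norm_div, Complex.norm_real, Real.norm_of_nonneg (Real.sqrt_nonneg _),
    div_lt_one (Real.sqrt_pos.2 h)]
  exact Real.lt_sqrt_of_sq_lt (by linarith)

/-- The radial homeomorphism of the plane onto the open unit disk. -/
def toDisk (ζ : ℂ) : Disk :=
  ⟨ζ / (√(1 + ‖ζ‖ ^ 2) : ℝ), mem_closedBall_zero_iff.2 (norm_div_sqrt_lt_one ζ).le⟩

lemma norm_toDisk_lt_one (ζ : ℂ) : ‖(toDisk ζ : ℂ)‖ < 1 := norm_div_sqrt_lt_one ζ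

lemma continuous_toDisk : Continuous fun ζ => (toDisk ζ : ℂ) := by
  have h : ∀ ζ : ℂ, ((√(1 + ‖ζ‖ ^ 2) : ℝ) : ℂ) ≠ 0 := fun ζ => by
    have h : (0 : ℝ) < 1 + ‖ζ‖ ^ 2 := by positivity
    exact_mod_cast (Real.sqrt_pos.2 h).ne'
  unfold toDisk
  exact continuous_id.div (by fun_prop) h

lemma one_sub_norm_toDisk_sq (ζ : ℂ) : 1 - ‖(toDisk ζ : ℂ)‖ ^ 2 = (1 + ‖ζ‖ ^ 2)⁻¹ := by
  have h : (0 : ℝ) < 1 + ‖ζ‖ ^ 2 := by positivity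
  simp only [toDisk]
  rw [norm_div, Complex.norm_real, Real.norm_of_nonneg (Real.sqrt_nonneg _), div_pow,
    Real.sq_sqrt h.le]
  field_simp
  ring

lemma toDisk_injective : Function.Injective fun ζ => (toDisk ζ : ℂ) := by
  intro ζ ζ' h
  simp only at h
  have h1 := one_sub_norm_toDisk_sq ζ
  rw [h, one_sub_norm_toDisk_sq, inv_inj] at h1
  have h0 : (0 : ℝ) < 1 + ‖ζ‖ ^ 2 := by positivity
  have h2 : ((√(1 + ‖ζ‖ ^ 2) : ℝ) : ℂ) ≠ 0 := by exact_mod_cast (Real.sqrt_pos.2 h0).ne'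
  simp only [toDisk, h1] at h
  exact (div_left_inj' h2).1 h

lemma solidTorusPoint_eq_page (ζ : ℂ) (t : ℝ) : solidTorusPoint ζ t = page t (toDisk ζ) := by
  apply Subtype.ext
  simp only [solidTorusPoint, page]
  rw [one_sub_norm_toDisk_sq, Real.sqrt_inv]
  simp only [toDisk]
  push_cast
  rw [div_eq_inv_mul (Complex.exp _)]

lemma exists_pos_le_of_continuous {ι : Type*} [Finite ι] (f : ι → ℝ → ℝ)
    (hf : ∀ i, Continuous (f i)) (hpos : ∀ i, ∀ t ∈ Icc (0 : ℝ) 1, 0 < f i t) :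
    ∃ d > 0, ∀ i, ∀ t ∈ Icc (0 : ℝ) 1, d ≤ f i t := by
  have h1 : ∀ i, ∃ d > 0, ∀ t ∈ Icc (0 : ℝ) 1, d ≤ f i t := by
    intro i
    obtain ⟨t, ht, hm⟩ := isCompact_Icc.exists_isMinOn (nonempty_Icc.2 zero_le_one)
      (hf i).continuousOn
    exact ⟨f i t, hpos i t ht, fun u hu => hm hu⟩
  choose d hd hle using h1
  cases isEmpty_or_nonempty ι
  · exact ⟨1, one_pos, fun i => isEmptyElim i⟩
  · obtain ⟨i, hi⟩ := Finite.exists_min d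
    exact ⟨d i, hd i, fun j t ht => (hi j).trans (hle j t ht)⟩

/-- Closed braids in the solid torus that are close enough to each other are ambient isotopic. -/
lemma ambientIsotopic_of_close {ι : Type*} [Fintype ι] (ρ : Equiv.Perm ι) {d : ℝ} (hd : 0 < d)
    (γ γ' : ι → ℝ → ℂ) (hc : ∀ j, Continuous (γ j)) (hc' : ∀ j, Continuous (γ' j))
    (hρ : ∀ j, γ j 1 = γ (ρ j) 0) (hρ' : ∀ j, γ' j 1 = γ' (ρ j) 0)
    (h1 : ∀ t ∈ Icc (0 : ℝ) 1, ∀ j, ‖(toDisk (γ j t) : ℂ)‖ ≤ 1 - d)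
    (h2 : ∀ t ∈ Icc (0 : ℝ) 1, ∀ i j, i ≠ j → d ≤ ‖(toDisk (γ i t) : ℂ) - toDisk (γ j t)‖)
    (h3 : ∀ t ∈ Icc (0 : ℝ) 1, ∀ j,
      ‖(toDisk (γ' j t) : ℂ) - toDisk (γ j t)‖ ≤ d / (2 * (Fintype.card ι + 1))) :
    AmbientIsotopic (strandClosure γ) (strandClosure γ') := by
  -- Time is clamped to `[0, 1]`, where the hypotheses on the strands hold, so that the page maps
  -- are defined for every real time.
  let p : ℝ → ℝ := fun t => projIcc (0 : ℝ) 1 zero_le_one t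
  have hp : ∀ t, p t ∈ Icc (0 : ℝ) 1 := fun t => (projIcc (0 : ℝ) 1 zero_le_one t).2
  have hpt : ∀ t ∈ Icc (0 : ℝ) 1, p t = t := fun t ht => by
    simp only [p, projIcc_of_mem zero_le_one ht]
  have hpc : Continuous p := continuous_subtype_val.comp continuous_projIcc
  let a : ℝ → ι → ℂ := fun t j => toDisk (γ j (p t))
  let v : I → ℝ → ι → ℂ := fun s t j =>
    ((s : ℝ) : ℂ) * ((toDisk (γ' j (p t)) : ℂ) - toDisk (γ j (p t)))
  have ha : ∀ t j, ‖a t j‖ ≤ 1 - d := fun t j => h1 _ (hp t) j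
  have hv : ∀ s t j, ‖v s t j‖ ≤ d / (2 * (Fintype.card ι + 1)) := by
    intro s t j
    simp only [v, norm_mul, Complex.norm_real, Real.norm_of_nonneg s.2.1]
    calc _ ≤ 1 * (d / (2 * (Fintype.card ι + 1))) :=
          mul_le_mul s.2.2 (h3 _ (hp t) j) (norm_nonneg _) zero_le_one
      _ = _ := one_mul _
  let h : I → ℝ → Disk → Disk := fun s t z => ⟨push d (a t) (v s t) z,
    mem_closedBall_zero_iff.2 (norm_push_le hd (ha t) (hv s t) z.norm_le)⟩
  have hac : ∀ j, Continuous fun t => a t j := fun j =>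
    continuous_toDisk.comp ((hc j).comp hpc)
  have hac' : ∀ j, Continuous fun t => (toDisk (γ' j (p t)) : ℂ) := fun j =>
    continuous_toDisk.comp ((hc' j).comp hpc)
  have hmove : ∀ t ∈ Icc (0 : ℝ) 1, ∀ j, h 1 t (toDisk (γ j t)) = toDisk (γ' j t) := by
    intro t ht j
    apply Subtype.ext
    have := push_apply (v := v 1 t) hd (fun i j => h2 _ (hp t) i j : ∀ i j, i ≠ j →
      d ≤ ‖a t i - a t j‖) j
    simp only [h]
    simpa only [a, v, hpt t ht, Icc.coe_one, Complex.ofReal_one, one_mul, add_sub_cancel] using this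
  refine ambientIsotopic_of_pages h ?_ ?_ ?_ ?_ ?_ _ _ ?_ ?_
  · refine Continuous.subtype_mk ?_ _
    simp only [push, v]
    refine (by fun_prop : Continuous fun x : I × I × Disk => (x.2.2 : ℂ)).add ?_
    refine continuous_finsetSum _ fun j _ => ?_
    have k1 : Continuous fun x : I × I × Disk => a x.2.1 j :=
      (hac j).comp (by fun_prop : Continuous fun x : I × I × Disk => (x.2.1 : ℝ))
    have k2 : Continuous fun x : I × I × Disk => (toDisk (γ' j (p x.2.1)) : ℂ) :=
      (hac' j).comp (by fun_prop : Continuous fun x : I × I × Disk => (x.2.1 : ℝ))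
    have k3 : Continuous fun x : I × I × Disk => (toDisk (γ j (p x.2.1)) : ℂ) := k1
    fun_prop
  · intro s t _
    constructor
    · intro z z' e
      exact Subtype.ext (push_injective hd (hv s t) (congrArg Subtype.val e))
    · intro y
      obtain ⟨z, hz⟩ := push_surjective hd (a := a t) (hv s t) y
      have hz1 : ‖z‖ ≤ 1 := by
        by_contra! hlt
        rw [push_eq_self hd (ha t) hlt.le] at hz
        rw [hz] at hlt
        linarith [y.norm_le]
      exact ⟨⟨z, mem_closedBall_zero_iff.2 hz1⟩, Subtype.ext hz⟩
  · intro s t z hz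
    exact Subtype.ext (push_eq_self hd (ha t) hz.ge)
  -- The strands at times `0` and `1` occupy the same points up to `ρ`, so the two sums of bumps
  -- differ by a reindexing.
  · intro s
    ext z
    simp only [h, push, a, v, hpt 0 (by simp), hpt 1 (by simp), hρ, hρ']
    congr 1
    exact (Equiv.sum_comp ρ fun j => ((max 0 (1 - ‖(z : ℂ) - toDisk (γ j 0)‖ / d) : ℝ) : ℂ) *
      (((s : ℝ) : ℂ) * ((toDisk (γ' j 0) : ℂ) - toDisk (γ j 0)))).symm
  · intro t z
    apply Subtype.ext
    simp [h, push, v]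
  · rintro x ⟨j, t, ht, rfl⟩
    refine ⟨t, ht, toDisk (γ j t), solidTorusPoint_eq_page _ _, j, t, ht, ?_⟩
    rw [hmove t ht, solidTorusPoint_eq_page]
  · rintro x ⟨j, t, ht, rfl⟩
    refine ⟨t, ht, toDisk (γ j t), ⟨j, t, ht, (solidTorusPoint_eq_page _ _).symm⟩, ?_⟩
    rw [hmove t ht, solidTorusPoint_eq_page]

/-- The closures of the braids in a continuous family of closed braids are ambient isotopic. -/
theorem ambientIsotopic_of_braidHomotopy {ι : Type*} [Finite ι] (ρ : Equiv.Perm ι)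
    (γ : ℝ → ι → ℝ → ℂ) (hc : ∀ j, Continuous fun x : ℝ × ℝ => γ x.1 j x.2)
    (hρ : ∀ s j, γ s j 1 = γ s (ρ j) 0)
    (hinj : ∀ s ∈ Icc (0 : ℝ) 1, ∀ t ∈ Icc (0 : ℝ) 1, Function.Injective fun j => γ s j t) :
    AmbientIsotopic (strandClosure (γ 0)) (strandClosure (γ 1)) := by
  cases nonempty_fintype ι
  have hcs : ∀ s j, Continuous (γ s j) := fun s j =>
    (hc j).comp (by fun_prop : Continuous fun t : ℝ => (s, t))
  -- Isotopy is an equivalence relation, so by connectedness of `[0, 1]` it is enough to compare the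
  -- braid at `s` with those at nearby parameters.
  refine isPreconnected_Icc.induction₂ (s := Icc (0 : ℝ) 1)
    (fun s s' => AmbientIsotopic (strandClosure (γ s)) (strandClosure (γ s'))) ?_
    (fun _ _ _ _ _ _ => AmbientIsotopic.trans) (fun _ _ _ _ => AmbientIsotopic.symm)
    (by simp) (by simp)
  intro s hs
  have hcd : ∀ j, Continuous fun t => (toDisk (γ s j t) : ℂ) := fun j =>
    continuous_toDisk.comp (hcs s j)
  obtain ⟨d₁, hd₁, H₁⟩ := exists_pos_le_of_continuous
    (fun j t => 1 - ‖(toDisk (γ s j t) : ℂ)‖)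
    (fun j => by have := hcd j; fun_prop)
    (fun j t _ => sub_pos.2 (norm_toDisk_lt_one _))
  obtain ⟨d₂, hd₂, H₂⟩ := exists_pos_le_of_continuous
    (fun (ij : {ij : ι × ι // ij.1 ≠ ij.2}) t =>
      ‖(toDisk (γ s ij.1.1 t) : ℂ) - toDisk (γ s ij.1.2 t)‖)
    (fun ij => ((hcd _).sub (hcd _)).norm)
    (fun ij t ht => norm_pos_iff.2 (sub_ne_zero.2 fun h =>
      ij.2 (hinj s hs t ht (toDisk_injective h))))
  -- `d₁` bounds the distance from the strands to the binding, `d₂` the distance between different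
  -- strands.
  set d := min d₁ d₂ with hd
  have hd0 : 0 < d := lt_min hd₁ hd₂
  have hev : ∀ᶠ s' in 𝓝 s, ∀ t ∈ Icc (0 : ℝ) 1, ∀ j,
      ‖(toDisk (γ s' j t) : ℂ) - toDisk (γ s j t)‖ ≤ d / (2 * (Fintype.card ι + 1)) := by
    refine isCompact_Icc.eventually_forall_of_forall_eventually fun t _ => ?_
    rw [eventually_all]
    intro j
    have k1 : Continuous fun x : ℝ × ℝ =>
        ‖(toDisk (γ x.1 j x.2) : ℂ) - toDisk (γ s j x.2)‖ :=
      ((continuous_toDisk.comp (hc j)).sub ((hcd j).comp continuous_snd)).norm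
    have k2 : (0 : ℝ) < d / (2 * (Fintype.card ι + 1)) := by positivity
    have k3 := k1.tendsto (s, t)
    simp only [sub_self, norm_zero] at k3
    exact (k3.eventually (gt_mem_nhds k2)).mono fun x hx => le_of_lt hx
  refine (hev.filter_mono nhdsWithin_le_nhds).mono fun s' hs' => ?_
  refine ambientIsotopic_of_close ρ hd0 _ _ (hcs s) (hcs s') (hρ s) (hρ s') ?_ ?_ hs'
  · intro t ht j
    have := H₁ j t ht
    have : d ≤ d₁ := min_le_left _ _
    linarith
  · intro t ht i j hij
    exact (min_le_right _ _).trans (H₂ ⟨(i, j), hij⟩ t ht)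

/-! ### Braids whose strands move in blocks -/

/-- The closure of a braid whose strands come in `n` groups that the braid permutes cyclically. -/
def groupClosure (n : ℕ) {κ : Type*} (Z : ℕ → κ → ℝ → ℂ) : Set S3 :=
  {x | ∃ g < n, ∃ k, ∃ t ∈ Icc (0 : ℝ) 1, x = solidTorusPoint (Z g k t) t}

lemma strandClosure_eq_groupClosure {n : ℕ} {κ : Type*} (Z : ℕ → κ → ℝ → ℂ) :
    strandClosure (fun (j : Fin n × κ) => Z j.1 j.2) = groupClosure n Z := by
  ext x
  constructor
  · rintro ⟨⟨g, k⟩, t, ht, rfl⟩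
    exact ⟨g, g.2, k, t, ht, rfl⟩
  · rintro ⟨g, hg, k, t, ht, rfl⟩
    exact ⟨(⟨g, hg⟩, k), t, ht, rfl⟩

/-- Blocks are indexed by `ℕ`, so that a strand is followed through `g + t` from `0` to `n` without
reduction modulo `n`; the closing-up is then the single condition `hlast`. -/
theorem ambientIsotopic_of_groupHomotopy {n : ℕ} (hn : n ≠ 0) {κ : Type*} [Finite κ]
    (Z : ℝ → ℕ → κ → ℝ → ℂ) (hc : ∀ g k, Continuous fun x : ℝ × ℝ => Z x.1 g k x.2)
    (hstep : ∀ s g k, Z s g k 1 = Z s (g + 1) k 0) (hlast : ∀ s k, Z s n k 0 = Z s 0 k 0)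
    (hinj : ∀ s ∈ Icc (0 : ℝ) 1, ∀ t ∈ Icc (0 : ℝ) 1, ∀ g < n, ∀ g' < n, ∀ k k',
      Z s g k t = Z s g' k' t → g = g' ∧ k = k') :
    AmbientIsotopic (groupClosure n (Z 0)) (groupClosure n (Z 1)) := by
  rw [← strandClosure_eq_groupClosure, ← strandClosure_eq_groupClosure]
  obtain ⟨n, rfl⟩ := Nat.exists_eq_succ_of_ne_zero hn
  refine ambientIsotopic_of_braidHomotopy ((finRotate (n + 1)).prodCongr (Equiv.refl κ))
    (fun s (j : Fin (n + 1) × κ) => Z s j.1 j.2) (fun j => hc _ _) ?_ ?_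
  · rintro s ⟨g, k⟩
    simp only [Equiv.prodCongr_apply, Prod.map_apply, finRotate_apply, Equiv.refl_apply,
      Fin.val_add_one, hstep]
    split_ifs with h
    · rw [h, ← hlast]
      rfl
    · rfl
  · rintro s hs t ht ⟨g, k⟩ ⟨g', k'⟩ h
    obtain ⟨h1, h2⟩ := hinj s hs t ht g g.2 g' g'.2 k k' h
    rw [Prod.mk.injEq]
    exact ⟨Fin.ext h1, h2⟩

/-- The point at the fraction `x / n` of the unit circle. -/
def rot (n : ℕ) (x : ℝ) : ℂ := Complex.exp ((2 * Real.pi * x / n : ℝ) * Complex.I)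

lemma rot_ne_zero (n : ℕ) (x : ℝ) : rot n x ≠ 0 := Complex.exp_ne_zero _

lemma rot_zero (n : ℕ) : rot n 0 = 1 := by simp [rot]

lemma rot_self {n : ℕ} (hn : n ≠ 0) : rot n n = 1 := by
  have : (n : ℝ) ≠ 0 := by exact_mod_cast hn
  rw [rot, mul_div_assoc, div_self this]
  simp

@[fun_prop]
lemma Continuous.rot {X : Type*} [TopologicalSpace X] (n : ℕ) {f : X → ℝ} (hf : Continuous f) :
    Continuous fun x => rot n (f x) := by
  unfold TwistedTorus.rot
  fun_prop

/-- The `n` open sectors of half-angle `π/n` centred at the directions `g + x` are disjoint, and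
`exp` is injective on the strip over one of them. This rules out all collisions between blocks that
stay in their sectors. -/
lemma eq_of_rot_mul_exp_eq {n : ℕ} (x : ℝ) {g g' : ℕ} (hg : g < n) (hg' : g' < n) {W W' : ℂ}
    (hW : |W.im| < Real.pi / n) (hW' : |W'.im| < Real.pi / n)
    (h : rot n (g + x) * Complex.exp W = rot n (g' + x) * Complex.exp W') : g = g' ∧ W = W' := by
  have hn : (0 : ℝ) < n := by exact_mod_cast (by omega : 0 < n)
  have hpi := Real.pi_pos
  rw [rot, rot, ← Complex.exp_add, ← Complex.exp_add, Complex.exp_eq_exp_iff_exists_int] at h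
  obtain ⟨N, hN⟩ := h
  have him := congrArg Complex.im hN
  simp only [Complex.add_im, Complex.mul_im, Complex.ofReal_re, Complex.I_im, Complex.ofReal_im,
    Complex.I_re, mul_one, mul_zero, add_zero, Complex.intCast_re, Complex.intCast_im,
    zero_mul, Complex.mul_re, Complex.re_ofNat, Complex.im_ofNat, sub_zero] at him
  have e : (2 * Real.pi / n) * ((g : ℝ) - g' - n * N) = W'.im - W.im := by
    field_simp at him ⊢
    linarith
  have habs : |((g : ℝ) - g' - n * N)| < 1 := by
    have h1 : |W'.im - W.im| < 2 * Real.pi / n := by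
      refine (abs_sub _ _).trans_lt ?_
      rw [show 2 * Real.pi / n = Real.pi / n + Real.pi / n by ring]
      linarith
    rw [← e, abs_mul, abs_of_pos (by positivity)] at h1
    exact (mul_lt_iff_lt_one_right (by positivity)).1 h1
  have hz : (g : ℤ) - g' - n * N = 0 := by
    rw [← Int.abs_lt_one_iff]
    exact_mod_cast habs
  have hN0 : N = 0 := by
    rcases lt_trichotomy N 0 with h | h | h
    · have : (n : ℤ) * N ≤ n * (-1) := by gcongr; omega
      omega
    · exact h
    · have : (n : ℤ) * 1 ≤ n * N := by gcongr; omega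
      omega
  subst hN0
  have hgg : g = g' := by omega
  subst hgg
  exact ⟨rfl, by simpa using hN⟩

lemma exists_ball_subset_sector {n : ℕ} (hn : n ≠ 0) : ∃ r > 0, r ≤ 1 ∧ ∀ F : ℂ, ‖F - 1‖ < r →
    ∃ W : ℂ, Complex.exp W = F ∧ |W.im| < Real.pi / n := by
  have h1 : ContinuousAt Complex.arg 1 := Complex.continuousAt_arg (by simp)
  have hpos : 0 < Real.pi / n := by
    have : (0 : ℝ) < n := by exact_mod_cast Nat.pos_of_ne_zero hn
    have := Real.pi_pos
    positivity
  obtain ⟨r, hr, H⟩ := Metric.continuousAt_iff.1 h1 _ hpos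
  refine ⟨min r 1, by positivity, min_le_right _ _, fun F hF => ?_⟩
  have hF0 : F ≠ 0 := by
    rintro rfl
    have := hF.trans_le (min_le_right _ _)
    simp at this
  refine ⟨Complex.log F, Complex.exp_log hF0, ?_⟩
  have := H (x := F) (by rw [dist_eq_norm]; exact hF.trans_le (min_le_left _ _))
  simpa [Complex.log_im, Real.dist_eq] using this

/-- The position of the `g`-th group of strands of the torus braid, in the part of the braid where
all groups move, followed by a pause. -/
def groupAngle (g : ℕ) (t : ℝ) : ℝ := g + min (2 * t) 1

/-- The angle of rotation of the strands in the `g`-th group about their centre. -/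
def twistAngle (n g : ℕ) (t : ℝ) : ℝ := -(2 * Real.pi * n) * max 0 (2 * (g + t) - 2 * n + 1)

lemma groupAngle_one (g : ℕ) : groupAngle g 1 = groupAngle (g + 1) 0 := by
  simp [groupAngle]

lemma twistAngle_one (n g : ℕ) : twistAngle n g 1 = twistAngle n (g + 1) 0 := by
  simp [twistAngle]

lemma rot_groupAngle_last {n : ℕ} (hn : n ≠ 0) :
    rot n (groupAngle n 0) = rot n (groupAngle 0 0) := by
  simp [groupAngle, rot_self hn, rot_zero]

lemma twistAngle_last (n : ℕ) : twistAngle n n 0 = -(2 * Real.pi * n) := by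
  simp [twistAngle]

lemma twistAngle_eq_zero {n g : ℕ} {t : ℝ} (h : 2 * (g + t) ≤ 2 * (n : ℝ) - 1) :
    twistAngle n g t = 0 := by
  rw [twistAngle, max_eq_left (by linarith), mul_zero]

lemma twistAngle_zero {n : ℕ} (hn : n ≠ 0) : twistAngle n 0 0 = 0 := by
  refine twistAngle_eq_zero ?_
  have : (1 : ℝ) ≤ n := by exact_mod_cast Nat.one_le_iff_ne_zero.2 hn
  push_cast
  linarith

lemma exp_neg_two_pi_nat (n : ℕ) (x : ℝ) :
    Complex.exp ((x - 2 * Real.pi * n : ℝ) * Complex.I) = Complex.exp (x * Complex.I) := by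
  rw [Complex.exp_eq_exp_iff_exists_int]
  exact ⟨-n, by push_cast; ring⟩

@[fun_prop]
lemma Continuous.groupAngle {X : Type*} [TopologicalSpace X] (g : ℕ) {f : X → ℝ}
    (hf : Continuous f) : Continuous fun x => groupAngle g (f x) := by
  unfold TwistedTorus.groupAngle
  fun_prop

@[fun_prop]
lemma Continuous.twistAngle {X : Type*} [TopologicalSpace X] (n g : ℕ) {f : X → ℝ}
    (hf : Continuous f) : Continuous fun x => twistAngle n g (f x) := by
  unfold TwistedTorus.twistAngle
  fun_prop

lemma exp_mul_I_injOn {x y : ℝ} (hx : |x| < Real.pi) (hy : |y| < Real.pi)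
    (h : Complex.exp (x * Complex.I) = Complex.exp (y * Complex.I)) : x = y := by
  rw [abs_lt] at hx hy
  have := Complex.exp_inj_of_neg_pi_lt_of_le_pi (x := x * Complex.I) (y := y * Complex.I)
    (by simpa using hx.1) (by simpa using hx.2.le) (by simpa using hy.1) (by simpa using hy.2.le) h
  simpa using this

lemma normSq_exp_mul_I_sub_one (x : ℝ) :
    Complex.normSq (Complex.exp (x * Complex.I) - 1) = 2 - 2 * Real.cos x := by
  rw [Complex.exp_mul_I, Complex.normSq_apply]
  simp only [← Complex.ofReal_cos, ← Complex.ofReal_sin, Complex.sub_re, Complex.sub_im,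
    Complex.add_re, Complex.add_im, Complex.mul_re, Complex.mul_im, Complex.ofReal_re,
    Complex.ofReal_im, Complex.I_re, Complex.I_im, Complex.one_re, Complex.one_im]
  linear_combination Real.sin_sq_add_cos_sq x

/-- A full twist of the block about `1` keeps its points at their distances from `1`. Points of the
unit circle in the other sectors are farther away, which is a comparison of cosines. -/
lemma rot_mul_exp_ne {n g : ℕ} (hg : 1 ≤ g) (hgn : g < n) {a a' θ : ℝ} (ha : |a| < Real.pi / n)
    (ha' : |a'| < Real.pi / n) :
    rot n g * Complex.exp (a' * Complex.I) ≠
      1 + Complex.exp (θ * Complex.I) * (Complex.exp (a * Complex.I) - 1) := by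
  intro h
  have hn : (0 : ℝ) < n := by exact_mod_cast (by omega : 0 < n)
  have hpi := Real.pi_pos
  have e : Complex.exp ((2 * Real.pi * g / n + a' : ℝ) * Complex.I) - 1 =
      Complex.exp (θ * Complex.I) * (Complex.exp (a * Complex.I) - 1) := by
    rw [rot, ← Complex.exp_add] at h
    rw [sub_eq_iff_eq_add', ← h]
    push_cast
    ring_nf
  have e2 := congrArg Complex.normSq e
  rw [Complex.normSq_mul, Complex.normSq_eq_norm_sq (Complex.exp (θ * Complex.I)),
    Complex.norm_exp_ofReal_mul_I, normSq_exp_mul_I_sub_one, normSq_exp_mul_I_sub_one] at e2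
  have hc : Real.cos (2 * Real.pi * g / n + a') = Real.cos a := by linarith
  set δ := Real.pi / n with hδ
  have h1 : 2 * Real.pi * g / n = 2 * g * δ := by rw [hδ]; ring
  have hδ0 : 0 < δ := by positivity
  have hnδ : n * δ = Real.pi := by rw [hδ]; field_simp
  have hg1 : (1 : ℝ) ≤ g := by exact_mod_cast hg
  have hg2 : (g : ℝ) + 1 ≤ n := by exact_mod_cast hgn
  rw [h1] at hc
  rw [abs_lt] at ha'
  have hδπ : δ ≤ Real.pi := by nlinarith
  have l1 : Real.cos δ < Real.cos a := by
    rw [← Real.cos_abs a]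
    exact Real.cos_lt_cos_of_nonneg_of_le_pi (abs_nonneg a) hδπ ha
  have l2 : Real.cos (2 * g * δ + a') < Real.cos δ := by
    have k1 : δ < 2 * g * δ + a' := by nlinarith
    have k2 : 2 * g * δ + a' < 2 * Real.pi - δ := by nlinarith
    rcases le_total (2 * g * δ + a') Real.pi with h | h
    · exact Real.cos_lt_cos_of_nonneg_of_le_pi hδ0.le h k1
    · rw [← Real.cos_two_pi_sub (2 * g * δ + a')]
      exact Real.cos_lt_cos_of_nonneg_of_le_pi hδ0.le (by linarith) (by linarith)
  linarith

/-! ### From rigidly twisted blocks to evenly rotating ones -/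

/-- Shrinking the groups of strands to small ones, and turning the whole braid. -/
lemma ambientIsotopic_shrink {n : ℕ} (hn : n ≠ 0) {κ : Type*} [Finite κ] (c s₀ : ℝ)
    (hs₀ : 0 < s₀) (hs₁ : s₀ ≤ 1)
    (a : κ → ℝ) (ha : Function.Injective a) (hπ : ∀ k, |a k| < Real.pi / n) :
    AmbientIsotopic
      (groupClosure n fun g k t => Complex.exp (c * Complex.I) * (rot n (groupAngle g t) *
        (1 + Complex.exp (twistAngle n g t * Complex.I) * (Complex.exp (a k * Complex.I) - 1))))
      (groupClosure n fun g k t => rot n (groupAngle g t) *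
        (1 + Complex.exp (twistAngle n g t * Complex.I) *
          (Complex.exp ((s₀ * a k : ℝ) * Complex.I) - 1))) := by
  have key := ambientIsotopic_of_groupHomotopy hn (κ := κ)
    (fun s g k t => Complex.exp (((1 - s) * c : ℝ) * Complex.I) * (rot n (groupAngle g t) *
        (1 + Complex.exp (twistAngle n g t * Complex.I) *
          (Complex.exp (((1 - s + s * s₀) * a k : ℝ) * Complex.I) - 1))))
    (by intro g k; fun_prop)
    (by intro s g k; rw [groupAngle_one, twistAngle_one])
    (by
      intro s k
      have := exp_neg_two_pi_nat n 0
      rw [zero_sub] at this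
      rw [rot_groupAngle_last hn, twistAngle_last, twistAngle_zero hn, this])
    ?_
  · simpa using key
  intro s hs t ht g hg g' hg' k k' h
  have h1 := mul_left_cancel₀ (Complex.exp_ne_zero _) h
  have hμ0 : 0 < 1 - s + s * s₀ := by nlinarith [hs.1, hs.2]
  have hμ1 : 1 - s + s * s₀ ≤ 1 := by nlinarith [hs.1, hs.2]
  set μ := 1 - s + s * s₀
  have hn1 : (1 : ℝ) ≤ n := by exact_mod_cast Nat.one_le_iff_ne_zero.2 hn
  have hμa : ∀ k, |μ * a k| < Real.pi / n := by
    intro k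
    rw [abs_mul, abs_of_pos hμ0]
    exact (mul_le_of_le_one_left (abs_nonneg _) hμ1).trans_lt (hπ k)
  have hnπ : Real.pi / n ≤ Real.pi := div_le_self Real.pi_pos.le hn1
  have hinj : ∀ k k', Complex.exp ((μ * a k : ℝ) * Complex.I) =
      Complex.exp ((μ * a k' : ℝ) * Complex.I) → k = k' := by
    intro k k' h
    exact ha (mul_left_cancel₀ hμ0.ne'
      (exp_mul_I_injOn ((hμa k).trans_le hnπ) ((hμa k').trans_le hnπ) h))
  have hW : ∀ k, |(((μ * a k : ℝ) : ℂ) * Complex.I).im| < Real.pi / n := by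
    intro k
    simpa using hμa k
  have untwisted : twistAngle n g t = 0 → twistAngle n g' t = 0 → g = g' ∧ k = k' := by
    intro h2 h3
    rw [h2, h3] at h1
    simp only [Complex.ofReal_zero, zero_mul, Complex.exp_zero, one_mul, add_sub_cancel] at h1
    obtain ⟨e1, e2⟩ := eq_of_rot_mul_exp_eq (min (2 * t) 1) hg hg' (hW k) (hW k') h1
    exact ⟨e1, hinj _ _ (by rw [e2])⟩
  have hzero : ∀ {g : ℕ}, g + 1 < n → twistAngle n g t = 0 := by
    intro g hg
    apply twistAngle_eq_zero
    have : (g : ℝ) + 2 ≤ n := by exact_mod_cast hg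
    linarith [ht.2]
  -- In the first half nothing twists and all points lie on the unit circle. In the second half only
  -- block `n - 1`, by then centred at `1`, twists.
  rcases le_total t (1 / 2) with h2 | h2
  · have : ∀ {g : ℕ}, g < n → twistAngle n g t = 0 := by
      intro g hg
      apply twistAngle_eq_zero
      have : (g : ℝ) + 1 ≤ n := by exact_mod_cast hg
      linarith
    exact untwisted (this hg) (this hg')
  have hga : ∀ g : ℕ, groupAngle g t = (g + 1 : ℕ) := by
    intro g
    rw [groupAngle, min_eq_right (by linarith)]
    push_cast
    ring
  have hcross : ∀ {g g' : ℕ} {k k' : κ}, g < n → g' < n → ¬ g + 1 < n → g' + 1 < n →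
      rot n (groupAngle g t) * (1 + Complex.exp (twistAngle n g t * Complex.I) *
          (Complex.exp ((μ * a k : ℝ) * Complex.I) - 1)) =
      rot n (groupAngle g' t) * (1 + Complex.exp (twistAngle n g' t * Complex.I) *
          (Complex.exp ((μ * a k' : ℝ) * Complex.I) - 1)) → False := by
    intro g g' k k' h3 h4 h5 h6 h7
    have hgn : g + 1 = n := by omega
    rw [hga, hga, hgn, rot_self hn, hzero h6] at h7
    simp only [Complex.ofReal_zero, zero_mul, Complex.exp_zero, one_mul, add_sub_cancel] at h7
    exact rot_mul_exp_ne (by omega) h6 (hμa k) (hμa k') h7.symm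
  by_cases h3 : g + 1 < n
  · by_cases h4 : g' + 1 < n
    · exact untwisted (hzero h3) (hzero h4)
    · exact (hcross hg' hg h4 h3 h1.symm).elim
  · by_cases h4 : g' + 1 < n
    · exact (hcross hg hg' h3 h4 h1).elim
    · have hgg : g = g' := by omega
      subst hgg
      have h5 := mul_left_cancel₀ (Complex.exp_ne_zero _)
        (add_left_cancel (mul_left_cancel₀ (rot_ne_zero _ _) h1))
      exact ⟨rfl, hinj _ _ (sub_left_injective h5)⟩

/-- The remainder of the exponential function after the linear term. -/
def expRem (W : ℂ) : ℂ := Complex.exp W - 1 - W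

/-- The derivative `exp z - 1` has norm at most `2‖z‖ ≤ 1/2` on this ball. -/
lemma norm_expRem_sub_le {W W' : ℂ} (hW : ‖W‖ ≤ 1 / 4) (hW' : ‖W'‖ ≤ 1 / 4) :
    ‖expRem W - expRem W'‖ ≤ 1 / 2 * ‖W - W'‖ := by
  refine (convex_closedBall (0 : ℂ) (1 / 4)).norm_image_sub_le_of_norm_hasDerivWithin_le
    (f := expRem) (f' := fun z => Complex.exp z - 1) (fun z _ => ?_) (fun z hz => ?_)
    (mem_closedBall_zero_iff.2 hW') (mem_closedBall_zero_iff.2 hW)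
  · exact (((Complex.hasDerivAt_exp z).sub_const 1).sub (hasDerivAt_id z)).hasDerivWithinAt
  · rw [mem_closedBall_zero_iff] at hz
    have := Complex.norm_exp_sub_one_le (x := z) (by linarith)
    linarith

lemma norm_interp_expRem_sub_le {s : ℝ} (hs : s ∈ Icc (0 : ℝ) 1) {u V V' : ℂ} (hu : ‖u‖ = 1)
    (hV : ‖V‖ ≤ 1 / 4) (hV' : ‖V'‖ ≤ 1 / 4) :
    ‖((1 - s : ℝ) * (u * expRem V) + (s : ℝ) * expRem (u * V)) -
      ((1 - s : ℝ) * (u * expRem V') + (s : ℝ) * expRem (u * V'))‖ ≤ 1 / 2 * ‖V - V'‖ := by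
  have huV : ∀ {V : ℂ}, ‖V‖ ≤ 1 / 4 → ‖u * V‖ ≤ 1 / 4 := by
    intro V h; rwa [norm_mul, hu, one_mul]
  rw [show ((1 - s : ℝ) * (u * expRem V) + (s : ℝ) * expRem (u * V)) -
      ((1 - s : ℝ) * (u * expRem V') + (s : ℝ) * expRem (u * V')) =
      (1 - s : ℝ) * (u * (expRem V - expRem V')) + (s : ℝ) * (expRem (u * V) - expRem (u * V'))
      by ring]
  refine (norm_add_le _ _).trans ?_
  rw [norm_mul, norm_mul, norm_mul, hu, Complex.norm_real, Complex.norm_real, one_mul,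
    Real.norm_of_nonneg hs.1, Real.norm_of_nonneg (sub_nonneg.2 hs.2)]
  have h1 := norm_expRem_sub_le hV hV'
  have h2 := norm_expRem_sub_le (huV hV) (huV hV')
  rw [← mul_sub, norm_mul, hu, one_mul] at h2
  nlinarith [mul_le_mul_of_nonneg_left h1 (sub_nonneg.2 hs.2), mul_le_mul_of_nonneg_left h2 hs.1]

/-- Replacing the chords of the unit circle that small groups of strands span by segments in
logarithmic coordinates. -/
lemma ambientIsotopic_log {n : ℕ} (hn : n ≠ 0) {κ : Type*} [Finite κ] {r : ℝ} (hr : r ≤ 1)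
    (hsec : ∀ F : ℂ, ‖F - 1‖ < r → ∃ W : ℂ, Complex.exp W = F ∧ |W.im| < Real.pi / n)
    (b : κ → ℝ) (hb : Function.Injective b) (hbr : ∀ k, |b k| < r / 4) :
    AmbientIsotopic
      (groupClosure n fun g k t => rot n (groupAngle g t) *
        (1 + Complex.exp (twistAngle n g t * Complex.I) * (Complex.exp (b k * Complex.I) - 1)))
      (groupClosure n fun g k t => rot n (groupAngle g t) *
        Complex.exp (Complex.exp (twistAngle n g t * Complex.I) * (b k * Complex.I))) := by
  -- Both `1 + u (exp V - 1)` and `exp (u V)` are `1 + u V` plus a remainder. Only the remainders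
  -- are interpolated, so the linear term always dominates.
  let G : ℝ → ℂ → ℂ → ℂ := fun s u V =>
    1 + (u * V + ((1 - s : ℝ) * (u * expRem V) + (s : ℝ) * expRem (u * V)))
  have hG : Continuous fun x : ℝ × ℂ × ℂ => G x.1 x.2.1 x.2.2 := by
    simp only [G, expRem]
    fun_prop
  have key := ambientIsotopic_of_groupHomotopy hn (κ := κ)
    (fun s g k t => rot n (groupAngle g t) *
      G s (Complex.exp (twistAngle n g t * Complex.I)) (b k * Complex.I))
    (by
      intro g k
      refine Continuous.mul (by fun_prop) (hG.comp (by fun_prop :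
        Continuous fun x : ℝ × ℝ => (x.1, Complex.exp (twistAngle n g x.2 * Complex.I),
          (b k * Complex.I : ℂ)))))
    (by intro s g k; rw [groupAngle_one, twistAngle_one])
    (by
      intro s k
      have := exp_neg_two_pi_nat n 0
      rw [zero_sub] at this
      rw [rot_groupAngle_last hn, twistAngle_last, twistAngle_zero hn, this])
    ?_
  · have e0 : ∀ u V, G 0 u V = 1 + u * (Complex.exp V - 1) := by
      intro u V
      simp only [G, expRem, sub_zero, Complex.ofReal_one, Complex.ofReal_zero]
      ring
    have e1 : ∀ u V, G 1 u V = Complex.exp (u * V) := by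
      intro u V
      simp only [G, expRem, sub_self, Complex.ofReal_one, Complex.ofReal_zero]
      ring
    simpa only [e0, e1] using key
  intro s hs t ht g hg g' hg' k k' h
  have hV : ∀ k, ‖(b k * Complex.I : ℂ)‖ < r / 4 := by
    intro k
    simpa using hbr k
  have hV' : ∀ k, ‖(b k * Complex.I : ℂ)‖ ≤ 1 / 4 := fun k => by linarith [hV k]
  have hball : ∀ {u : ℂ} k, ‖u‖ = 1 → ‖G s u (b k * Complex.I) - 1‖ < r := by
    intro u k hu
    have h1 := norm_interp_expRem_sub_le hs hu (hV' k) (V' := 0) (by simp)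
    have h2 : expRem 0 = 0 := by simp [expRem]
    simp only [h2, mul_zero, add_zero, sub_zero] at h1
    simp only [G, add_sub_cancel_left]
    refine (norm_add_le _ _).trans_lt ?_
    rw [norm_mul u, hu]
    linarith [hV k, norm_nonneg (b k * Complex.I : ℂ)]
  have hu : ∀ g, ‖Complex.exp (twistAngle n g t * Complex.I)‖ = 1 := fun g =>
    Complex.norm_exp_ofReal_mul_I _
  obtain ⟨W, hW, hWi⟩ := hsec _ (hball k (hu g))
  obtain ⟨W', hW', hWi'⟩ := hsec _ (hball k' (hu g'))
  have h' := h
  rw [← hW, ← hW'] at h'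
  obtain ⟨rfl, e⟩ := eq_of_rot_mul_exp_eq (min (2 * t) 1) hg hg' hWi hWi' h'
  refine ⟨rfl, ?_⟩
  have h1 := mul_left_cancel₀ (rot_ne_zero _ _) h
  simp only [G, add_right_inj] at h1
  have h2 := norm_interp_expRem_sub_le hs (hu g) (hV' k) (hV' k')
  set u := Complex.exp (twistAngle n g t * Complex.I)
  -- If two points coincide, the difference of the linear terms cancels that of the remainders,
  -- which is at most half as long; so both vanish.
  have h3 : ‖u * (b k * Complex.I) - u * (b k' * Complex.I)‖ ≤
      1 / 2 * ‖(b k * Complex.I : ℂ) - b k' * Complex.I‖ := by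
    refine le_of_eq_of_le ?_ h2
    rw [← norm_neg]
    exact congrArg norm (by linear_combination -h1)
  rw [← mul_sub, norm_mul, hu, one_mul] at h3
  have h4 : ‖(b k * Complex.I : ℂ) - b k' * Complex.I‖ = 0 := by
    linarith [norm_nonneg ((b k * Complex.I : ℂ) - b k' * Complex.I)]
  rw [norm_eq_zero, ← sub_mul, mul_eq_zero, sub_eq_zero] at h4
  exact hb (by simpa using h4)

lemma abs_im_exp_mul_le (θ b : ℝ) : |(Complex.exp (θ * Complex.I) * (b * Complex.I)).im| ≤ |b| := by
  refine (Complex.abs_im_le_norm _).trans ?_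
  rw [norm_mul, Complex.norm_exp_ofReal_mul_I]
  simp

lemma lerp_lt {s x y M : ℝ} (hs : s ∈ Icc (0 : ℝ) 1) (hx : |x| < M) (hy : |y| < M) :
    |(1 - s) * x + s * y| < M := by
  rw [abs_lt] at *
  obtain ⟨h0, h1⟩ := hs
  have k : ∀ {x y : ℝ}, x < M → y < M → (1 - s) * x + s * y < M := by
    intro x y hx hy
    rcases h0.eq_or_lt with rfl | h
    · simpa
    · nlinarith
  refine ⟨?_, k hx.2 hy.2⟩
  have := k (x := -x) (y := -y) (by linarith) (by linarith)
  linarith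

/-- Spreading the rotation of the groups evenly. -/
lemma ambientIsotopic_spread {n : ℕ} (hn : n ≠ 0) {κ : Type*} [Finite κ]
    (b : κ → ℝ) (hb : Function.Injective b) (hbn : ∀ k, |b k| < Real.pi / n) :
    AmbientIsotopic
      (groupClosure n fun g k t => rot n (groupAngle g t) *
        Complex.exp (Complex.exp (twistAngle n g t * Complex.I) * (b k * Complex.I)))
      (groupClosure n fun g k t => rot n (g + t) *
        Complex.exp (Complex.exp ((Real.pi / 2 - 2 * Real.pi * (g + t) : ℝ) * Complex.I) *
          (b k * Complex.I))) := by
  have key := ambientIsotopic_of_groupHomotopy hn (κ := κ)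
    (fun s g k t => rot n (g + ((1 - s) * min (2 * t) 1 + s * t)) *
      Complex.exp (Complex.exp (((1 - s) * twistAngle n g t +
        s * (Real.pi / 2 - 2 * Real.pi * (g + t)) : ℝ) * Complex.I) * (b k * Complex.I)))
    (by intro g k; fun_prop)
    (by
      intro s g k
      rw [twistAngle_one]
      norm_num)
    (by
      intro s k
      -- Both ends of the interpolation turn by `-2πn` in total, so the braid closes up for every
      -- `s`.
      rw [twistAngle_last, twistAngle_zero hn]
      have := exp_neg_two_pi_nat n (s * (Real.pi / 2))
      simp only [CharP.cast_eq_zero, mul_zero, add_zero, zero_add, min_eq_left zero_le_one,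
        rot_self hn, rot_zero, sub_zero]
      rw [← this]
      ring_nf)
    ?_
  · simpa [groupAngle] using key
  intro s hs t ht g hg g' hg' k k' h
  obtain ⟨rfl, e⟩ := eq_of_rot_mul_exp_eq _ hg hg'
    ((abs_im_exp_mul_le _ _).trans_lt (hbn k)) ((abs_im_exp_mul_le _ _).trans_lt (hbn k')) h
  refine ⟨rfl, hb ?_⟩
  simpa using mul_left_cancel₀ (Complex.exp_ne_zero _) e

/-! ### Translated unit circles in polar coordinates -/

/-- The distance from the origin to the point in direction `θ` of the unit circle about `b`. -/
def circleRadius (b θ : ℝ) : ℝ := b * Real.cos θ + √(1 - (b * Real.sin θ) ^ 2)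

lemma one_sub_mul_sin_sq_pos {b : ℝ} (hb : |b| < 1) (θ : ℝ) :
    0 < 1 - (b * Real.sin θ) ^ 2 ∧ (b * Real.cos θ) ^ 2 < 1 - (b * Real.sin θ) ^ 2 := by
  have h1 : b ^ 2 < 1 := (sq_lt_one_iff_abs_lt_one b).2 hb
  have h2 : (b * Real.cos θ) ^ 2 < 1 - (b * Real.sin θ) ^ 2 := by
    have := Real.sin_sq_add_cos_sq θ
    have : (b * Real.cos θ) ^ 2 + (b * Real.sin θ) ^ 2 = b ^ 2 := by
      linear_combination b ^ 2 * this
    linarith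
  exact ⟨(sq_nonneg _).trans_lt h2, h2⟩

lemma abs_mul_cos_lt {b : ℝ} (hb : |b| < 1) (θ : ℝ) :
    |b * Real.cos θ| < √(1 - (b * Real.sin θ) ^ 2) := by
  rw [← Real.sqrt_sq_eq_abs]
  exact Real.sqrt_lt_sqrt (sq_nonneg _) (one_sub_mul_sin_sq_pos hb θ).2

lemma circleRadius_pos {b : ℝ} (hb : |b| < 1) (θ : ℝ) : 0 < circleRadius b θ := by
  have := (abs_lt.1 (abs_mul_cos_lt hb θ)).1
  rw [circleRadius]
  linarith

lemma strictMonoOn_lerp_arcsin {s : ℝ} (hs : s ∈ Icc (0 : ℝ) 1) {n : ℕ} (hn : n ≠ 0) :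
    StrictMonoOn (fun y => (1 - s) * y + s * (Real.arcsin y / n)) (Icc (-1) 1) := by
  intro x hx y hy hxy
  have hn' : (0 : ℝ) < n := by exact_mod_cast Nat.pos_of_ne_zero hn
  have h1 : Real.arcsin x / n < Real.arcsin y / n :=
    div_lt_div_of_pos_right (Real.strictMonoOn_arcsin hx hy hxy) hn'
  obtain ⟨h0, h2⟩ := hs
  simp only
  rcases h0.eq_or_lt with rfl | h
  · simpa
  · nlinarith

lemma strictAntiOn_lerp_log {s : ℝ} (hs : s ∈ Icc (0 : ℝ) 1) :
    StrictAntiOn (fun y => (1 - s) * -y + s * -Real.log (y + 1)) (Ioi (-1)) := by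
  intro x hx y hy hxy
  rw [mem_Ioi] at hx hy
  have h1 : Real.log (x + 1) < Real.log (y + 1) :=
    Real.log_lt_log (by linarith) (by linarith)
  obtain ⟨h0, h2⟩ := hs
  simp only
  rcases h0.eq_or_lt with rfl | h
  · simpa
  · nlinarith

/-- Deforming the strands to the ones that a union of parallel closed 1-braids about the other axis
traces out. -/
lemma ambientIsotopic_circle {n : ℕ} (hn : 2 ≤ n) {κ : Type*} [Finite κ]
    (b : κ → ℝ) (hb : Function.Injective b) (hb1 : ∀ k, |b k| < 1)
    (hbn : ∀ k, |b k| < Real.pi / n) :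
    AmbientIsotopic
      (groupClosure n fun g k t => rot n (g + t) *
        Complex.exp (Complex.exp ((Real.pi / 2 - 2 * Real.pi * (g + t) : ℝ) * Complex.I) *
          (b k * Complex.I)))
      (groupClosure n fun g k t => rot n (g + t) *
        Complex.exp ((-Real.log (circleRadius (b k) (2 * Real.pi * t)) : ℝ) +
          (Real.arcsin (b k * Real.sin (2 * Real.pi * t)) / n : ℝ) * Complex.I)) := by
  have hn0 : n ≠ 0 := by omega
  have hn' : (2 : ℝ) ≤ n := by exact_mod_cast hn
  have hrc : ∀ k, Continuous fun t => Real.log (circleRadius (b k) (2 * Real.pi * t)) := by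
    intro k
    refine Continuous.log ?_ fun t => (circleRadius_pos (hb1 k) _).ne'
    unfold circleRadius
    fun_prop
  let X : ℝ → κ → ℝ → ℝ := fun s k t => (1 - s) * (b k * Real.sin (2 * Real.pi * t)) +
    s * (Real.arcsin (b k * Real.sin (2 * Real.pi * t)) / n)
  let Y : ℝ → κ → ℝ → ℝ := fun s k t => (1 - s) * -(b k * Real.cos (2 * Real.pi * t)) +
    s * -Real.log (circleRadius (b k) (2 * Real.pi * t))
  have key := ambientIsotopic_of_groupHomotopy hn0 (κ := κ)
    (fun s g k t => rot n (g + t) * Complex.exp ((Y s k t : ℝ) + (X s k t : ℝ) * Complex.I))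
    (by
      intro g k
      have hc : Continuous fun x : ℝ × ℝ => Real.log (circleRadius (b k) (2 * Real.pi * x.2)) :=
        (hrc k).comp continuous_snd
      have ha := Real.continuous_arcsin
      simp only [X, Y]
      fun_prop)
    (by intro s g k; simp [X, Y, circleRadius])
    (by intro s k; simp [X, Y, rot_self hn0, rot_zero])
    ?_
  -- The phase `π/2` turns the displacement into `-b cos 2πt + i b sin 2πt`, the first-order part in
  -- `b` of the target, apart from the factor `1/n` in the angle.
  · have e0 : ∀ (g : ℕ) k t, Complex.exp ((Real.pi / 2 - 2 * Real.pi * (g + t) : ℝ) * Complex.I) *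
          (b k * Complex.I) = (Y 0 k t : ℝ) + (X 0 k t : ℝ) * Complex.I := by
      intro g k t
      have := exp_neg_two_pi_nat g (Real.pi / 2 - 2 * Real.pi * t)
      rw [show Real.pi / 2 - 2 * Real.pi * (g + t) =
        Real.pi / 2 - 2 * Real.pi * t - 2 * Real.pi * g by ring, this, Complex.exp_mul_I,
        ← Complex.ofReal_cos, ← Complex.ofReal_sin, Real.cos_pi_div_two_sub,
        Real.sin_pi_div_two_sub]
      simp only [X, Y]
      push_cast
      linear_combination (b k * Complex.cos (2 * Real.pi * t)) * Complex.I_sq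
    simp only [e0]
    simpa [X, Y] using key
  intro s hs t ht g hg g' hg' k k' h
  have hx1 : ∀ k, |b k * Real.sin (2 * Real.pi * t)| ≤ |b k| := by
    intro k
    rw [abs_mul]
    exact mul_le_of_le_one_right (abs_nonneg _) (Real.abs_sin_le_one _)
  have hX : ∀ k, |((Y s k t : ℝ) + (X s k t : ℝ) * Complex.I : ℂ).im| < Real.pi / n := by
    intro k
    have : |X s k t| < Real.pi / n := by
      refine lerp_lt hs ((hx1 k).trans_lt (hbn k)) ?_
      rw [abs_div, Nat.abs_cast]
      refine div_lt_div_of_pos_right ?_ (by linarith)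
      have := Real.arcsin_le_pi_div_two (b k * Real.sin (2 * Real.pi * t))
      have := Real.neg_pi_div_two_le_arcsin (b k * Real.sin (2 * Real.pi * t))
      rw [abs_lt]
      constructor <;> linarith [Real.pi_pos]
    simpa using this
  obtain ⟨rfl, e⟩ := eq_of_rot_mul_exp_eq t hg hg' (hX k) (hX k') h
  refine ⟨rfl, hb ?_⟩
  have eX : X s k t = X s k' t := by simpa using congrArg Complex.im e
  have eY : Y s k t = Y s k' t := by simpa using congrArg Complex.re e
  have hmem : ∀ k, b k * Real.sin (2 * Real.pi * t) ∈ Icc (-1 : ℝ) 1 := fun k =>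
    abs_le.1 ((hx1 k).trans (hb1 k).le)
  have hsin := (strictMonoOn_lerp_arcsin hs hn0).injOn (hmem k) (hmem k') eX
  -- The angular coordinate determines `b sin 2πt`, hence `b` unless the sine vanishes. Then
  -- `circleRadius b` is `b cos 2πt + 1`, and the radial coordinate determines `b`.
  by_cases h0 : Real.sin (2 * Real.pi * t) = 0
  · have hcos : Real.cos (2 * Real.pi * t) ≠ 0 := by
      intro h
      have := Real.sin_sq_add_cos_sq (2 * Real.pi * t)
      rw [h0, h] at this
      norm_num at this
    simp only [Y, circleRadius, h0, mul_zero, ne_eq, OfNat.ofNat_ne_zero, not_false_eq_true,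
      zero_pow, sub_zero, Real.sqrt_one] at eY
    have hmem' : ∀ k, b k * Real.cos (2 * Real.pi * t) ∈ Ioi (-1 : ℝ) := by
      intro k
      have h1 : |b k * Real.cos (2 * Real.pi * t)| < 1 := by
        rw [abs_mul]
        exact (mul_le_of_le_one_right (abs_nonneg _) (Real.abs_cos_le_one _)).trans_lt (hb1 k)
      exact (abs_lt.1 h1).1
    exact mul_right_cancel₀ hcos ((strictAntiOn_lerp_log hs).injOn (hmem' k) (hmem' k') eY)
  · exact mul_right_cancel₀ h0 hsin

/-! ### Exchanging the two axes -/

/-- The isometry `(z, w) ↦ (z cos θ + w sin θ, w cos θ - z sin θ)` of the three-sphere. -/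
def sphereRotation (θ : ℝ) (x : S3) : S3 :=
  ⟨(Real.cos θ * x.1.1 + Real.sin θ * x.1.2, Real.cos θ * x.1.2 - Real.sin θ * x.1.1), by
    have h := x.2
    have h1 := Real.sin_sq_add_cos_sq θ
    rw [← Complex.normSq_eq_norm_sq, ← Complex.normSq_eq_norm_sq] at *
    simp only [Complex.normSq_apply, Complex.add_re, Complex.add_im, Complex.sub_re,
      Complex.sub_im, Complex.re_ofReal_mul, Complex.im_ofReal_mul] at *
    linear_combination h + (x.1.1.re * x.1.1.re + x.1.1.im * x.1.1.im +
      (x.1.2.re * x.1.2.re + x.1.2.im * x.1.2.im)) * h1⟩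

lemma sphereRotation_neg_sphereRotation (θ : ℝ) (x : S3) :
    sphereRotation (-θ) (sphereRotation θ x) = x := by
  have h1 : (Real.sin θ : ℂ) ^ 2 + (Real.cos θ : ℂ) ^ 2 = 1 := by
    exact_mod_cast Real.sin_sq_add_cos_sq θ
  apply Subtype.ext
  apply Prod.ext <;> simp only [sphereRotation, Real.cos_neg, Real.sin_neg] <;> push_cast at *
  · linear_combination x.1.1 * h1
  · linear_combination x.1.2 * h1

lemma ambientIsotopic_swap (A : Set S3) :
    AmbientIsotopic A (sphereRotation (Real.pi / 2) '' A) := by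
  have key := ambientIsotopic_of_bijective
    (fun s => sphereRotation ((s : ℝ) * (Real.pi / 2)))
    (by unfold sphereRotation; fun_prop)
    (fun s => Function.bijective_iff_has_inverse.2
      ⟨sphereRotation (-(s * (Real.pi / 2))), sphereRotation_neg_sphereRotation _, fun x => by
        simpa using sphereRotation_neg_sphereRotation (-((s : ℝ) * (Real.pi / 2))) x⟩)
    (by intro x; apply Subtype.ext; simp [sphereRotation]) A
  simpa using key

/-- A point of the torus braid around the other axis. -/
lemma sphereRotation_solidTorusPoint {v ω : ℂ} {r t t' : ℝ} (hr : 0 < r)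
    (hv : Complex.exp (2 * Real.pi * t' * Complex.I) = -v)
    (hω : ω = r * Complex.exp (2 * Real.pi * t * Complex.I)) :
    sphereRotation (Real.pi / 2) (solidTorusPoint (v * (r⁻¹ : ℝ)) t) = solidTorusPoint ω t' := by
  have hv1 : ‖v‖ = 1 := by rw [← norm_neg, ← hv, norm_exp_two_pi_mul]
  have hω1 : ‖ω‖ = r := by
    rw [hω, norm_mul, norm_exp_two_pi_mul, Complex.norm_real, Real.norm_of_nonneg hr.le, mul_one]
  have hs : √(1 + ‖v * (r⁻¹ : ℝ)‖ ^ 2) = √(1 + ‖ω‖ ^ 2) / r := by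
    rw [norm_mul, hv1, Complex.norm_real, Real.norm_of_nonneg (by positivity), hω1, one_mul,
      ← Real.sqrt_sq hr.le, ← Real.sqrt_div' _ (by positivity), Real.sqrt_sq hr.le]
    congr 1
    field_simp
    ring
  have hr' : (r : ℂ) ≠ 0 := by exact_mod_cast hr.ne'
  have hq : ((√(1 + ‖ω‖ ^ 2) : ℝ) : ℂ) ≠ 0 := by
    have : (0 : ℝ) < 1 + ‖ω‖ ^ 2 := by positivity
    exact_mod_cast (Real.sqrt_pos.2 this).ne'
  apply Subtype.ext
  apply Prod.ext
  · simp only [sphereRotation, solidTorusPoint, hs, Real.cos_pi_div_two, Real.sin_pi_div_two]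
    push_cast
    rw [hω] at hq ⊢
    field_simp
    simp
  · simp only [sphereRotation, solidTorusPoint, hs, Real.cos_pi_div_two, Real.sin_pi_div_two, hv]
    push_cast
    field_simp
    simp

/-- The law of sines in the triangle with vertices `0`, `b` and the point of the circle in direction
`θ`: as seen from `b`, that point has direction `θ + arcsin (b sin θ)`. -/
lemma exp_mul_circleRadius {b : ℝ} (hb : |b| < 1) (θ : ℝ) :
    Complex.exp ((θ + Real.arcsin (b * Real.sin θ) : ℝ) * Complex.I) + b =
      circleRadius b θ * Complex.exp (θ * Complex.I) := by
  have h1 : |b * Real.sin θ| < 1 := by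
    rw [abs_mul]
    exact (mul_le_of_le_one_right (abs_nonneg _) (Real.abs_sin_le_one _)).trans_lt hb
  rw [abs_lt] at h1
  have hsq : √(1 - (b * Real.sin θ) ^ 2) = Real.cos (Real.arcsin (b * Real.sin θ)) :=
    (Real.cos_arcsin _).symm
  have e1 : Real.sin (Real.arcsin (b * Real.sin θ)) = b * Real.sin θ :=
    Real.sin_arcsin h1.1.le h1.2.le
  have e2 := Real.sin_sq_add_cos_sq θ
  rw [circleRadius, hsq, Complex.exp_mul_I, Complex.exp_mul_I, ← Complex.ofReal_cos,
    ← Complex.ofReal_sin, ← Complex.ofReal_cos, ← Complex.ofReal_sin, Real.cos_add, Real.sin_add, e1]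
  apply Complex.ext <;> simp [-Complex.ofReal_cos, -Complex.ofReal_sin]
  · linear_combination -b * e2
  · ring

lemma eq_circleRadius {b ρ θ : ℝ} (hb : |b| < 1) (hρ : 0 ≤ ρ)
    (h : ‖ρ * Complex.exp (θ * Complex.I) - b‖ = 1) : ρ = circleRadius b θ := by
  have h1 : Complex.normSq (ρ * Complex.exp (θ * Complex.I) - b) = 1 := by
    rw [Complex.normSq_eq_norm_sq, h, one_pow]
  rw [Complex.exp_mul_I, ← Complex.ofReal_cos, ← Complex.ofReal_sin, Complex.normSq_apply] at h1
  simp [-Complex.ofReal_cos, -Complex.ofReal_sin] at h1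
  have h2 : (ρ - b * Real.cos θ) ^ 2 = 1 - (b * Real.sin θ) ^ 2 := by
    linear_combination h1 - (ρ ^ 2 - b ^ 2) * Real.sin_sq_add_cos_sq θ
  have h3 := abs_mul_cos_lt hb θ
  have h4 : ρ - b * Real.cos θ = √(1 - (b * Real.sin θ) ^ 2) := by
    rw [← h2, Real.sqrt_sq_eq_abs] at h3 ⊢
    rcases abs_cases (ρ - b * Real.cos θ) with ⟨h5, _⟩ | ⟨h5, _⟩
    · exact h5.symm
    · rw [h5, abs_lt] at h3
      linarith [h3.2]
  rw [circleRadius, ← h4]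
  ring

lemma rot_pow {n : ℕ} (hn : n ≠ 0) (x : ℝ) (y : ℝ) :
    (rot n x * Complex.exp ((y / n : ℝ) * Complex.I)) ^ n =
      Complex.exp ((2 * Real.pi * x + y : ℝ) * Complex.I) := by
  have : (n : ℂ) ≠ 0 := by exact_mod_cast hn
  rw [rot, ← Complex.exp_add, ← Complex.exp_nat_mul]
  congr 1
  push_cast
  field_simp

lemma exp_two_pi_add_nat (g : ℕ) (t y : ℝ) :
    Complex.exp ((2 * Real.pi * (g + t) + y : ℝ) * Complex.I) =
      Complex.exp ((2 * Real.pi * t + y : ℝ) * Complex.I) := by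
  rw [← exp_neg_two_pi_nat g (2 * Real.pi * (g + t) + y)]
  ring_nf

/-- A union of closed 1-braids about the other axis that are obtained from each other by
translation. -/
lemma image_groupClosure_circle {n : ℕ} (hn : n ≠ 0) {κ : Type*} (b : κ → ℝ)
    (hb1 : ∀ k, |b k| < 1) :
    sphereRotation (Real.pi / 2) '' (groupClosure n fun g k t => rot n (g + t) *
        Complex.exp ((-Real.log (circleRadius (b k) (2 * Real.pi * t)) : ℝ) +
          (Real.arcsin (b k * Real.sin (2 * Real.pi * t)) / n : ℝ) * Complex.I)) =
      strandClosure fun k t => (-Complex.exp (2 * Real.pi * t * Complex.I)) ^ n + b k := by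
  have hn' : (n : ℂ) ≠ 0 := by exact_mod_cast hn
  have hform : ∀ (g : ℕ) k t, rot n (g + t) *
        Complex.exp ((-Real.log (circleRadius (b k) (2 * Real.pi * t)) : ℝ) +
          (Real.arcsin (b k * Real.sin (2 * Real.pi * t)) / n : ℝ) * Complex.I) =
      (rot n (g + t) * Complex.exp ((Real.arcsin (b k * Real.sin (2 * Real.pi * t)) / n : ℝ) *
        Complex.I)) * ((circleRadius (b k) (2 * Real.pi * t))⁻¹ : ℝ) := by
    intro g k t
    rw [Complex.exp_add, ← Complex.ofReal_exp, Real.exp_neg,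
      Real.exp_log (circleRadius_pos (hb1 k) _)]
    ring
  have hpow : ∀ (g : ℕ) k (t : ℝ), (rot n (g + t) *
        Complex.exp ((Real.arcsin (b k * Real.sin (2 * Real.pi * t)) / n : ℝ) *
        Complex.I)) ^ n + b k =
      circleRadius (b k) (2 * Real.pi * t) * Complex.exp (2 * Real.pi * t * Complex.I) := by
    intro g k t
    rw [rot_pow hn, exp_two_pi_add_nat, exp_mul_circleRadius (hb1 k)]
    push_cast
    rfl
  ext x
  constructor
  · rintro ⟨_, ⟨g, -, k, t, -, rfl⟩, rfl⟩
    simp only [hform]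
    set v := rot n (g + t) * Complex.exp ((Real.arcsin (b k * Real.sin (2 * Real.pi * t)) / n : ℝ) *
        Complex.I) with hv
    have hv1 : ‖-v‖ = 1 := by
      rw [norm_neg, hv, rot, norm_mul, Complex.norm_exp_ofReal_mul_I,
        Complex.norm_exp_ofReal_mul_I, one_mul]
    obtain ⟨t', ht', e⟩ := exists_exp_eq_of_norm_eq_one hv1
    refine ⟨k, t', ht', ?_⟩
    beta_reduce
    rw [e, neg_neg]
    exact sphereRotation_solidTorusPoint (circleRadius_pos (hb1 k) _) e (hpow g k t)
  · rintro ⟨k, t', -, rfl⟩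
    set v := -Complex.exp (2 * Real.pi * t' * Complex.I) with hv
    have hv1 : ‖v‖ = 1 := by rw [hv, norm_neg, norm_exp_two_pi_mul]
    have hω0 : v ^ n + b k ≠ 0 := by
      intro h
      have h1 := congrArg norm (eq_neg_of_add_eq_zero_left h)
      rw [norm_pow, hv1, one_pow, norm_neg, Complex.norm_real, Real.norm_eq_abs] at h1
      exact (hb1 k).ne h1.symm
    have hω1 : (‖v ^ n + b k‖ : ℂ) ≠ 0 := by simpa using hω0
    obtain ⟨t, ht, e⟩ := exists_exp_eq_of_norm_eq_one
      (u := (v ^ n + b k) / ‖v ^ n + b k‖) (by simp [hω0])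
    have hω : v ^ n + b k =
        (‖v ^ n + b k‖ : ℝ) * Complex.exp ((2 * Real.pi * t : ℝ) * Complex.I) := by
      push_cast
      rw [e]
      field_simp
    have hr := eq_circleRadius (hb1 k) (norm_nonneg _) (by
      rw [← hω, add_sub_cancel_right, norm_pow, hv1, one_pow])
    rw [hr] at hω
    have : NeZero n := ⟨hn⟩
    have hprim := Complex.isPrimitiveRoot_exp n hn
    set u := rot n (0 + t) * Complex.exp ((Real.arcsin (b k * Real.sin (2 * Real.pi * t)) / n : ℝ) *
      Complex.I) with hu
    have hvu : v ^ n = u ^ n := by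
      have := hpow 0 k t
      rw [Nat.cast_zero, ← hu] at this
      push_cast at hω
      exact add_right_cancel (hω.trans this.symm)
    have hu0 : u ≠ 0 := mul_ne_zero (rot_ne_zero _ _) (Complex.exp_ne_zero _)
    -- The `n` solutions `v` of `v ^ n = u ^ n` are the positions in the `n` blocks; the root of
    -- unity `v / u` tells which block.
    obtain ⟨g, hg, hgv⟩ := hprim.eq_pow_of_pow_eq_one (ξ := v / u) (by
      rw [div_pow, hvu, div_self (pow_ne_zero _ hu0)])
    have hvg : v = rot n (g + t) *
        Complex.exp ((Real.arcsin (b k * Real.sin (2 * Real.pi * t)) / n : ℝ) * Complex.I) := by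
      rw [eq_div_iff hu0] at hgv
      rw [← hgv, hu, rot, rot, ← mul_assoc, ← Complex.exp_nat_mul, ← Complex.exp_add]
      congr 2
      push_cast
      field_simp
      ring
    refine ⟨_, ⟨g, hg, k, t, ht, rfl⟩, ?_⟩
    simp only [hform]
    rw [← hvg]
    refine sphereRotation_solidTorusPoint (circleRadius_pos (hb1 k) _) ?_ ?_
    · rw [hv, neg_neg]
    · rw [hω]
      push_cast
      rfl

/-! ### Contracting translates to the standard unlink -/

/-- A closed braid whose strands are translates of each other is an unlink. -/
lemma isUnlink_translates (m n : ℕ) (b : Fin m → ℝ) (hb : StrictMono b) :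
    IsUnlink m
      (strandClosure fun k t => (-Complex.exp (2 * Real.pi * t * Complex.I)) ^ n + b k) := by
  let x : Fin m → ℝ := fun k => (k : ℕ) / ((m : ℝ) + 1)
  have hm : (0 : ℝ) < m + 1 := by positivity
  have hx0 : ∀ k, 0 ≤ x k := fun k => by positivity
  have hx1 : ∀ k, x k < 1 := fun k => by
    have : ((k : ℕ) : ℝ) < m := by exact_mod_cast k.2
    simp only [x]
    rw [div_lt_one hm]
    linarith
  have hxm : StrictMono x := fun i j hij => by
    have : ((i : ℕ) : ℝ) < (j : ℕ) := by exact_mod_cast hij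
    exact div_lt_div_of_pos_right this hm
  have hx2 : ∀ k, 0 < 1 - x k ^ 2 := fun k => by nlinarith [hx0 k, hx1 k]
  -- Solves `y / √(1 + y²) = x`, so that the constant strand at `y k` closes up to the circle `z = x
  -- k`.
  let y : Fin m → ℝ := fun k => x k / √(1 - x k ^ 2)
  have hy : StrictMono y := fun i j hij => by
    have h1 := hxm hij
    refine div_lt_div₀ h1 ?_ (hx0 j) (Real.sqrt_pos.2 (hx2 j))
    exact Real.sqrt_le_sqrt (by nlinarith [hx0 i, hx0 j])
  -- The common term shrinks to `0` while the real translations move to `y`. They stay in increasing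
  -- order, so the strands never meet.
  have key := ambientIsotopic_of_braidHomotopy (Equiv.refl (Fin m))
    (fun s k t => (1 - s : ℝ) * (-Complex.exp (2 * Real.pi * t * Complex.I)) ^ n +
      ((1 - s) * b k + s * y k : ℝ))
    (by intro k; fun_prop)
    (by intro s k; simp [Complex.exp_two_pi_mul_I])
    (by
      intro s hs t _ k k' h
      have h1 : (1 - s) * b k + s * y k = (1 - s) * b k' + s * y k' := by
        exact_mod_cast add_left_cancel h
      have hmono : StrictMono fun k => (1 - s) * b k + s * y k := by
        intro i j hij
        have h2 := hb hij
        have h3 := hy hij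
        obtain ⟨h4, h5⟩ := hs
        simp only
        rcases h4.eq_or_lt with rfl | h6
        · simpa
        · nlinarith
      exact hmono.injective h1)
  have hstd : standardUnlink m = strandClosure fun (k : Fin m) (_ : ℝ) => (y k : ℂ) := by
    have hcoord : ∀ k, (toDisk (y k) : ℂ) = x k := by
      intro k
      have hq := Real.sqrt_pos.2 (hx2 k)
      have h1 : 1 + ‖(y k : ℂ)‖ ^ 2 = (√(1 - x k ^ 2))⁻¹ ^ 2 := by
        rw [Complex.norm_real, Real.norm_eq_abs, sq_abs, div_pow, inv_pow,
          Real.sq_sqrt (hx2 k).le]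
        have := (hx2 k).ne'
        field_simp
        ring
      simp only [toDisk]
      rw [h1, Real.sqrt_sq (by positivity)]
      have : ((√(1 - x k ^ 2) : ℝ) : ℂ) ≠ 0 := by exact_mod_cast hq.ne'
      simp only [y]
      push_cast
      field_simp
    have hxc : ∀ k, ((x k : ℝ) : ℂ) = ((k : ℕ) : ℂ) / ((m : ℂ) + 1) := by
      intro k
      simp only [x]
      push_cast
      rfl
    ext p
    constructor
    · rintro ⟨k, hk⟩
      obtain ⟨t, ht, z, rfl⟩ := exists_page_eq p
      refine ⟨k, t, ht, ?_⟩
      rw [solidTorusPoint_eq_page]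
      congr 1
      apply Subtype.ext
      rw [hcoord, hxc]
      exact hk
    · rintro ⟨k, t, ht, rfl⟩
      refine ⟨k, ?_⟩
      rw [solidTorusPoint_eq_page, ← hxc, ← hcoord]
      rfl
  rw [IsUnlink, hstd]
  simpa using key

/-! ### The twisted torus link in block form, and the conclusion -/

/-- The strands of the twisted torus braid, in groups. -/
lemma twistedTorusLink_eq_groupClosure {m n : ℕ} (hm : m ≠ 0) (hn : n ≠ 0) :
    twistedTorusLink (m * n) m m (-(n : ℤ)) =
      groupClosure n fun g (k : Fin m) t =>
        Complex.exp ((2 * Real.pi * ((m - 1) / 2) / (m * n) : ℝ) * Complex.I) *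
        (rot n (groupAngle g t) * (1 + Complex.exp (twistAngle n g t * Complex.I) *
          (Complex.exp ((2 * Real.pi * ((k : ℕ) - (m - 1) / 2) / (m * n) : ℝ) * Complex.I)
            - 1))) := by
  have hm' : (m : ℂ) ≠ 0 := by exact_mod_cast hm
  have hn' : (n : ℂ) ≠ 0 := by exact_mod_cast hn
  have hn1 : (1 : ℝ) ≤ n := by exact_mod_cast Nat.one_le_iff_ne_zero.2 hn
  have hstrand : ∀ (g : ℕ) (hg : g < n) (k : Fin m) (j : Fin (m * n)) (_ : (j : ℕ) = g * m + k),
      ∀ t ∈ Icc (0 : ℝ) 1, twistedTorusStrand (m * n) m m (-(n : ℤ)) j t =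
        Complex.exp ((2 * Real.pi * ((m - 1) / 2) / (m * n) : ℝ) * Complex.I) *
        (rot n (groupAngle g t) * (1 + Complex.exp (twistAngle n g t * Complex.I) *
          (Complex.exp ((2 * Real.pi * ((k : ℕ) - (m - 1) / 2) / (m * n) : ℝ) * Complex.I)
            - 1))) := by
    intro g hg k j hj t ht
    have hg1 : (g : ℝ) + 1 ≤ n := by exact_mod_cast hg
    have hk := k.2
    rw [twistedTorusStrand, hj]
    split_ifs with h
    · rw [twistAngle_eq_zero (by linarith), groupAngle, min_eq_left (by linarith)]
      simp only [Complex.ofReal_zero, zero_mul, Complex.exp_zero, one_mul, add_sub_cancel]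
      rw [circlePoint, rot, ← Complex.exp_add, ← Complex.exp_add]
      congr 1
      push_cast
      field_simp
      ring
    · push Not at h
      rw [groupAngle, min_eq_right (by linarith), fullTwistStrand]
      -- Only the last block wraps around to the base points `0, …, m - 1`, where the twist takes
      -- place.
      by_cases hgn : g + 1 = n
      · have hmod : (g * m + k + m) % (m * n) = k := by
          rw [show g * m + k + m = k + m * n by rw [← hgn]; ring, Nat.add_mod_right,
            Nat.mod_eq_of_lt]
          exact hk.trans_le (Nat.le_mul_of_pos_right m (Nat.pos_of_ne_zero hn))
        have hgn' : (g : ℝ) + 1 = n := by exact_mod_cast hgn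
        have h1 : circlePoint (m * n) (((m : ℝ) - 1) / 2) =
            Complex.exp ((2 * Real.pi * ((m - 1) / 2) / (m * n) : ℝ) * Complex.I) := by
          rw [circlePoint]
          congr 1
          push_cast
          ring
        have h2 : circlePoint (m * n) (k : ℕ) =
            Complex.exp ((2 * Real.pi * ((m - 1) / 2) / (m * n) : ℝ) * Complex.I) *
            Complex.exp ((2 * Real.pi * ((k : ℕ) - (m - 1) / 2) / (m * n) : ℝ) * Complex.I) := by
          rw [circlePoint, ← Complex.exp_add]
          congr 1
          push_cast
          field_simp
          ring
        have h3 : Complex.exp (2 * Real.pi * (-(n : ℤ) : ℤ) * (2 * t - 1 : ℝ) * Complex.I) =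
            Complex.exp (twistAngle n g t * Complex.I) := by
          rw [twistAngle, max_eq_right (by linarith), show (g : ℝ) = n - 1 by linarith]
          congr 1
          push_cast
          ring
        rw [hmod, if_pos hk, hgn', rot_self hn, h1, h2, h3]
        ring
      · have hgn2 : g + 2 ≤ n := by omega
        have hmul : (g + 2) * m ≤ n * m := Nat.mul_le_mul_right m hgn2
        have hmod : (g * m + k + m) % (m * n) = g * m + k + m := by
          apply Nat.mod_eq_of_lt
          rw [mul_comm m n]
          linarith
        have hgn3 : (g : ℝ) + 2 ≤ n := by exact_mod_cast hgn2
        rw [hmod, if_neg (by omega), twistAngle_eq_zero (by linarith [ht.2])]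
        simp only [Complex.ofReal_zero, zero_mul, Complex.exp_zero, one_mul, add_sub_cancel]
        rw [circlePoint, rot, ← Complex.exp_add, ← Complex.exp_add]
        congr 1
        push_cast
        field_simp
        ring
  ext x
  constructor
  · rintro ⟨j, t, ht, rfl⟩
    have hmp := Nat.pos_of_ne_zero hm
    have hj : (j : ℕ) / m < n := Nat.div_lt_of_lt_mul j.2
    refine ⟨j / m, hj, ⟨j % m, Nat.mod_lt _ hmp⟩, t, ht, ?_⟩
    rw [hstrand _ hj ⟨j % m, Nat.mod_lt _ hmp⟩ j (Nat.div_add_mod' _ _).symm t ht]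
  · rintro ⟨g, hg, k, t, ht, rfl⟩
    have hlt : g * m + k < m * n := by
      have : (g + 1) * m ≤ n * m := Nat.mul_le_mul_right m hg
      have := k.2
      linarith
    refine ⟨⟨g * m + k, hlt⟩, t, ht, ?_⟩
    rw [hstrand g hg k ⟨g * m + k, hlt⟩ rfl t ht]

theorem isUnlink_twistedTorusLink {m n : ℕ} (hm : m ≠ 0) (hn : 2 ≤ n) :
    IsUnlink m (twistedTorusLink (m * n) m m (-(n : ℤ))) := by
  have hn0 : n ≠ 0 := by omega
  have hm1 : (0 : ℝ) < m := by exact_mod_cast Nat.pos_of_ne_zero hm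
  have hn2 : (2 : ℝ) ≤ n := by exact_mod_cast hn
  have hpi := Real.pi_pos
  let a : Fin m → ℝ := fun k => 2 * Real.pi * ((k : ℕ) - (m - 1) / 2) / (m * n)
  have ha : StrictMono a := fun i j hij => by
    have : ((i : ℕ) : ℝ) < (j : ℕ) := by exact_mod_cast hij
    simp only [a]
    gcongr
  have haπ : ∀ k, |a k| < Real.pi / n := by
    intro k
    have h1 : ((k : ℕ) : ℝ) + 1 ≤ m := by exact_mod_cast k.2
    have h2 : (0 : ℝ) ≤ (k : ℕ) := by positivity
    rw [show a k = Real.pi / n * ((2 * (k : ℕ) - (m - 1)) / m) by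
      simp only [a]; field_simp, abs_mul, abs_of_pos (by positivity)]
    refine mul_lt_of_lt_one_right (by positivity) ?_
    rw [abs_div, abs_of_pos hm1, div_lt_one hm1, abs_lt]
    constructor <;> linarith
  obtain ⟨r, hr, hr1, hsec⟩ := exists_ball_subset_sector hn0
  -- Since `|a k| < 2`, the factor `r / 8` gives the bound `|b k| < r / 4` that
  -- `ambientIsotopic_log` requires.
  let b : Fin m → ℝ := fun k => r / 8 * a k
  have hb : StrictMono b := fun i j hij => by
    have := ha hij
    simp only [b]
    gcongr
  have habs : ∀ k, |b k| = r / 8 * |a k| := fun k => by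
    simp only [b, abs_mul, abs_of_pos (show 0 < r / 8 by positivity)]
  have ha2 : ∀ k, |a k| < 2 := by
    intro k
    refine (haπ k).trans_le ?_
    rw [div_le_iff₀ (by linarith)]
    linarith [Real.pi_le_four]
  have hbr : ∀ k, |b k| < r / 4 := fun k => by
    rw [habs]
    nlinarith [ha2 k]
  have hbn : ∀ k, |b k| < Real.pi / n := fun k => by
    rw [habs]
    nlinarith [haπ k, abs_nonneg (a k)]
  have hb1 : ∀ k, |b k| < 1 := fun k => by linarith [hbr k]
  rw [twistedTorusLink_eq_groupClosure hm hn0]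
  refine (ambientIsotopic_shrink hn0 _ (r / 8) (by positivity) (by linarith) a ha.injective
    haπ).trans ?_
  refine (ambientIsotopic_log hn0 hr1 hsec b hb.injective hbr).trans ?_
  refine (ambientIsotopic_spread hn0 b hb.injective hbn).trans ?_
  refine (ambientIsotopic_circle hn b hb.injective hb1 hbn).trans ?_
  refine (ambientIsotopic_swap _).trans ?_
  rw [image_groupClosure_circle hn0 b hb1]
  exact isUnlink_translates m n b hb

end TwistedTorus

end

theorem mainTheorem10 (m n : ℕ) (hm : 2 ≤ m) (hn : 2 ≤ n) :
    TwistedTorus.IsUnlink m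
      (TwistedTorus.twistedTorusLink (m * n) m m (-(n : ℤ))) := by
  exact TwistedTorus.isUnlink_twistedTorusLink (by omega) hn
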